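/- **Setting.** Let $S$, $I$, $T$ be finite sets of schools, students and types; school $s$ has capacity $q_s\ge 1$ and a type function $\tau^s:I\cup\{\emptyset\}\to T$ with $\tau^s(\emptyset)\ne\tau^s(i)$ for all $i\in I$. For $J\subseteq I$ with $|J|\le q_s-1$, $\succsim_s^J$ is a weak order (complete and transitive) on $(I\setminus J)\cup\{\emptyset\}$, with asymmetric part $\succ_s^J$ and symmetric part $\sim_s^J$. Let $I^{t}$ be the set of students of type $t$ for $s$, and write $\tau=\tau^s$. Assume that every $\succsim_s$ satisfies the following (for assignments at which the orders are defined): * **PD**: if $i,j\in I\cup\{\emptyset\}$, $i,j\notin J\cup J'$, $|J\cap I^{\tau(i)}|\ge|J'\cap I^{\tau(i)}|$ and $|J\cap I^{\tau(j)}|\le|J'\cap I^{\tau(j)}|$, then $i\succ_s^Jj$ implies $i\succ_s^{J'}j$, and $i\succsim_s^Jj$ implies $i\succsim_s^{J'}j$. * **WO**: if $i,j\notin J\cup J'$ and $\tau(i)=\tau(j)$, then $i\succ_s^Jj$ implies $i\succ_s^{J'}j$, and $i\succsim_s^Jj$ implies $i\succsim_s^{J'}j$. * **DC**: if $i\ne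 j$ are students outside $J$ with $|J|+1\le q_s-1$, $\tau(i)=\tau(j)$, $i\succsim_s^Jj$, and $k\in(I\setminus(J\cup\{i,j\}))\cup\{\emptyset\}$, then $j\succ_s^{J\cup\{i\}}k$ implies $i\succ_s^{J\cup\{j\}}k$; $j\sim_s^{J\cup\{i\}}k$ implies $i\succsim_s^{J\cup\{j\}}k$; and $k\succ_s^{J\cup\{j\}}i$ implies $k\succ_s^{J\cup\{i\}}j$. A matching $\mu$ assigns to each student an element of $S\cup\{\emptyset\}$ with $|\mu(s)|\le q_s$, where $\mu(s)=\{i:\mu(i)=s\}$. Each student $i$ has a linear order over $S\cup\{\emptyset\}$, with strict part $P_i$ and weak part $R_i$. A matching $\mu$ is *stable* if it is non-wasteful ($sP_i\mu(i)$ implies $\emptyset\succ_s^{\mu(s)}i$ or $|\mu(s)|=q_s$), individually rational ($\mu(i)R_i\emptyset$ for all $i$, and $i\succsim_s^{\mu(s)\setminus\{i\}}\emptyset$ for all $s$ and $i\in\mu(s)$) and fair (there are no $i,j,s$ with $s=\mu(j)\,P_i\,\mu(i)$ and $i\succ_s^{\mu(s)\setminus\{j\}}j$). It is *student-optimal stable*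 if it is stable and no stable matching Pareto dominates it for the students. A mechanism $\phi$ (a map from preference profiles to matchings) is *student-optimal stable* if $\phi(P)$ is student-optimal stable for every $P$. It is *group strategy-proof* if there are no profile $P$, nonempty $G\subseteq I$ and misreports $P'_G$ with $\phi(P'_G,P_{-G})(j)\,P_j\,\phi(P)(j)$ for all $j\in G$. **The mechanism $\bar\phi$.** For each $s$, number the types, with the type of $\emptyset$ first, and the students, so that students of smaller types come first and, among students of one type, $i$ before $j$ implies $i\succsim_s j$ (by WO, this comparison does not depend on the given assignment). For $J\subseteq I$, define $C_s(J)$ by starting from $K=\emptyset$ and letting the students $a$ of $J$ arrive in increasing order. If $|K|<q_s$, add $a$ to $K$ exactly when $a\succsim_s^K\emptyset$. If $|K|=q_s$, replace $K$ by $(K\cup\{a\})\setminus\{r\}$, where $r$ is the student of largest number among those with lowest priority within $K'=K\cup\{a\}$, that is, those $r\in K'$ with $j\succsim_s^{K'\setminus\{r,j\}}r$ for all $j\in K'\setminus\{r\}$. The final $K$ is $C_s(J)$. Then $\bar\phi(P)$ is the outcome of student-proposing deferred acceptance with the choice functions $C=(C_s)_{s\in S}$: as long as possible, some student who is tentatively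 unmatched and has not been rejected by all acceptable schools applies to the most preferred school that has not rejected this student, and that school $s$ tentatively keeps $C_s$ of its current students together with the applicant and rejects the others. **Theorem.** If, in addition, $\succsim_s^J$ is a linear order (antisymmetric) for all $s\in S$ and all $J\subseteq I$ with $|J|\le q_s-1$, then $\bar\phi$ is well defined (admissible numberings exist, and the algorithm yields a matching) and, for every choice of the admissible numberings and of the order of applications, $\bar\phi$ is a student-optimal stable and group strategy-proof mechanism. -/

import Mathlib

/-- A linear order (complete, transitive, antisymmetric) on `S ∪ {∅}`: the preference relation of
a student. `none` is the outside option `∅`, and `R x y` says that `x` is at least as good as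
`y`. -/
@[ext]
structure Preference (S : Type*) where
  R : Option S → Option S → Prop
  total : ∀ x y, R x y ∨ R y x
  trans : ∀ x y z, R x y → R y z → R x z
  antisymm : ∀ x y, R x y → R y x → x = y

/-- Strict preference. -/
def Preference.P {S : Type*} (p : Preference S) (x y : Option S) : Prop :=
  p.R x y ∧ x ≠ y

/-- `Available J x`: `x ∈ (I \ J) ∪ {∅}`, where `none` stands for `∅`. -/
def Available {I : Type*} (J : Finset I) (x : Option I) : Prop :=
  ∀ i ∈ J, x ≠ some i

/-- A school choice market with students `I`, schools `S` and types `T`.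
* `q s` is the capacity of `s`;
* `type s` is the type function of `s` on `I ∪ {∅}`, where `∅` has a type that no student has;
* `prio s J x y` says `x ≿ y` in the priority order of `s` given the set `J` of assigned students.
  It is a weak order on `(I \ J) ∪ {∅}` whenever `|J| ≤ q s - 1`; the values of `prio` elsewhere
  carry no meaning. -/
structure Market (I S T : Type*) where
  q : S → ℕ
  q_pos : ∀ s, 1 ≤ q s
  type : S → Option I → T
  type_none_ne : ∀ s i, type s none ≠ type s (some i)
  prio : S → Finset I → Option I → Option I → Prop
  prio_total : ∀ s J, J.card < q s → ∀ x y, Available J x → Available J y →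
    prio s J x y ∨ prio s J y x
  prio_trans : ∀ s J, J.card < q s → ∀ x y z, Available J x → Available J y → Available J z →
    prio s J x y → prio s J y z → prio s J x z

namespace Market

variable {I S T : Type*}

/-- The asymmetric part `≻` of the priority order. -/
def sprio (M : Market I S T) (s : S) (J : Finset I) (x y : Option I) : Prop :=
  M.prio s J x y ∧ ¬ M.prio s J y x

/-- The symmetric part `∼` of the priority order. -/
def tie (M : Market I S T) (s : S) (J : Finset I) (x y : Option I) : Prop :=
  M.prio s J x y ∧ M.prio s J y x

/-- `|J ∩ I^t|`: the number of students in `J` whose type for `s` is `t`. -/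
def typeCount [DecidableEq T] (M : Market I S T) (s : S) (J : Finset I) (t : T) : ℕ :=
  (J.filter fun i => M.type s (some i) = t).card

/-- Preference for Diversity. -/
def PD [DecidableEq T] (M : Market I S T) (s : S) : Prop :=
  ∀ (x y : Option I) (J J' : Finset I), J.card < M.q s → J'.card < M.q s →
    Available J x → Available J y → Available J' x → Available J' y →
    M.typeCount s J' (M.type s x) ≤ M.typeCount s J (M.type s x) →
    M.typeCount s J (M.type s y) ≤ M.typeCount s J' (M.type s y) →
    (M.sprio s J x y → M.sprio s J' x y) ∧ (M.prio s J x y → M.prio s J' x y)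

/-- Within-Type Ordering. -/
def WO (M : Market I S T) (s : S) : Prop :=
  ∀ (x y : Option I) (J J' : Finset I), J.card < M.q s → J'.card < M.q s →
    Available J x → Available J y → Available J' x → Available J' y →
    M.type s x = M.type s y →
    (M.sprio s J x y → M.sprio s J' x y) ∧ (M.prio s J x y → M.prio s J' x y)

/-- Distributional Consistency of WO. Distinct `i`, `j` of equal type are students, because the
type of `∅` differs from that of every student; the competitor `k` may be `∅`. -/
def DC [DecidableEq I] (M : Market I S T) (s : S) : Prop :=
  ∀ (i j : I) (k : Option I) (J : Finset I), J.card + 1 < M.q s →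
    i ≠ j → i ∉ J → j ∉ J → Available J k → k ≠ some i → k ≠ some j →
    M.type s (some i) = M.type s (some j) → M.prio s J (some i) (some j) →
    (M.sprio s (insert i J) (some j) k → M.sprio s (insert j J) (some i) k) ∧
    (M.tie s (insert i J) (some j) k → M.prio s (insert j J) (some i) k) ∧
    (M.sprio s (insert j J) k (some i) → M.sprio s (insert i J) k (some j))

/-- Every priority order of `s` (given at most `q s - 1` assigned students) is a linear order. -/
def LinearPriorities (M : Market I S T) (s : S) : Prop :=
  ∀ J : Finset I, J.card < M.q s → ∀ x y, Available J x → Available J y →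
    M.prio s J x y → M.prio s J y x → x = y

/-- A matching, given by the map `i ↦ μ(i) ∈ S ∪ {∅}`; it respects the capacities. -/
@[ext]
structure Matching [Fintype I] [DecidableEq S] (M : Market I S T) where
  assign : I → Option S
  capacity : ∀ s, (Finset.univ.filter fun i => assign i = some s).card ≤ M.q s

section Stability

variable [Fintype I] [DecidableEq I] [DecidableEq S] {M : Market I S T}

/-- `μ(s)`: the set of students assigned to `s`. -/
def Matching.at (μ : M.Matching) (s : S) : Finset I :=
  Finset.univ.filter fun i => μ.assign i = some s

def NonWasteful (P : I → Preference S) (μ : M.Matching) : Prop :=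
  ∀ i s, (P i).P (some s) (μ.assign i) →
    M.sprio s (μ.at s) none (some i) ∨ (μ.at s).card = M.q s

def IndividuallyRational (P : I → Preference S) (μ : M.Matching) : Prop :=
  (∀ i, (P i).R (μ.assign i) none) ∧
    ∀ s, ∀ i ∈ μ.at s, M.prio s ((μ.at s).erase i) (some i) none

/-- `i` has justified envy toward `j` at `μ`. -/
def JustifiedEnvy (P : I → Preference S) (μ : M.Matching) (i j : I) : Prop :=
  ∃ s, μ.assign j = some s ∧ (P i).P (some s) (μ.assign i) ∧
    M.sprio s ((μ.at s).erase j) (some i) (some j)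

def Fair (P : I → Preference S) (μ : M.Matching) : Prop :=
  ∀ i j, ¬ JustifiedEnvy P μ i j

def Stable (P : I → Preference S) (μ : M.Matching) : Prop :=
  NonWasteful P μ ∧ IndividuallyRational P μ ∧ Fair P μ

def ParetoDominates (P : I → Preference S) (μ μ' : M.Matching) : Prop :=
  (∀ i, (P i).R (μ.assign i) (μ'.assign i)) ∧ ∃ i, (P i).P (μ.assign i) (μ'.assign i)

def StudentOptimalStable (P : I → Preference S) (μ : M.Matching) : Prop :=
  Stable P μ ∧ ∀ ν : M.Matching, Stable P ν → ¬ ParetoDominates P ν μ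

/-- A student-optimal stable mechanism. -/
def IsStudentOptimalStableMechanism (φ : (I → Preference S) → M.Matching) : Prop :=
  ∀ P, StudentOptimalStable P (φ P)

/-- No nonempty group `G` of students has, at any profile `P`, a joint misreport (a profile `P'`
that agrees with `P` outside `G`) which makes every member of `G` strictly better off. -/
def IsGroupStrategyProof (φ : (I → Preference S) → M.Matching) : Prop :=
  ∀ (P P' : I → Preference S) (G : Finset I), G.Nonempty → (∀ i, i ∉ G → P' i = P i) →
    ¬ ∀ j ∈ G, (P j).P ((φ P').assign j) ((φ P).assign j)

end Stability

section ChoiceFunction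

variable [Fintype I] [DecidableEq I] [Fintype T]

/-- For every school `s`, a numbering of the types in which `∅` has the first type, and a numbering
of the students such that (i) students of smaller types come first and (ii) within a type a student
who comes earlier has weakly higher priority. -/
structure Labelling (M : Market I S T) where
  typeNum : S → T ≃ Fin (Fintype.card T)
  typeNum_none : ∀ s, (typeNum s (M.type s none) : ℕ) = 0
  num : S → I ≃ Fin (Fintype.card I)
  lt_of_type_lt : ∀ s i j,
    typeNum s (M.type s (some i)) < typeNum s (M.type s (some j)) → num s i < num s j
  prio_of_lt : ∀ s i j, M.type s (some i) = M.type s (some j) → num s i < num s j →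
    ∀ J : Finset I, J.card < M.q s → i ∉ J → j ∉ J → M.prio s J (some i) (some j)

variable {M : Market I S T}

open Classical in
/-- The students who have the lowest priority within `K`. -/
noncomputable def lowest (M : Market I S T) (s : S) (K : Finset I) : Finset I :=
  K.filter fun i => ∀ j ∈ K, j ≠ i → M.prio s ((K.erase i).erase j) (some j) (some i)

open Classical in
/-- The last student (in the numbering for `s`) among those who have the lowest priority within
`K`, as a set: a singleton as soon as `lowest s K` is nonempty. -/
noncomputable def latestLowest (L : M.Labelling) (s : S) (K : Finset I) : Finset I :=
  (M.lowest s K).filter fun i => ∀ j ∈ M.lowest s K, L.num s j ≤ L.num s i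

open Classical in
/-- One step of the construction of the choice function: `a` arrives when `K` is held. -/
noncomputable def choiceStep (L : M.Labelling) (s : S) (K : Finset I) (a : I) : Finset I :=
  if K.card < M.q s then
    if M.prio s K (some a) none then insert a K else K
  else insert a K \ latestLowest L s (insert a K)

/-- The students of `J` in increasing order of their numbers for `s`. -/
def sorted (L : M.Labelling) (s : S) (J : Finset I) : List I :=
  ((List.finRange (Fintype.card I)).map (L.num s).symm).filter (· ∈ J)

/-- The choice function of `s` derived from the priority orders. -/
noncomputable def choice (L : M.Labelling) (s : S) (J : Finset I) : Finset I :=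
  (sorted L s J).foldl (choiceStep L s) ∅

end ChoiceFunction

end Market

section DeferredAcceptance

variable {I S : Type*}

/-- State of the student-proposing deferred acceptance algorithm: `held s` is the set of students
tentatively matched to `s`, `rejected i` the set of schools that have rejected `i` so far. -/
structure SPDAState (I S : Type*) where
  held : S → Finset I
  rejected : I → Set S

def SPDAState.init (I S : Type*) : SPDAState I S := ⟨fun _ => ∅, fun _ => ∅⟩

/-- `i` is not tentatively matched and has not been rejected by all schools acceptable to `i`. -/
def SPDAState.Active (P : I → Preference S) (σ : SPDAState I S) (i : I) : Prop :=
  (∀ s, i ∉ σ.held s) ∧ ∃ s, (P i).R (some s) none ∧ s ∉ σ.rejected i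

/-- The state after `i` has applied to `s`: `s` holds its choice from the students it held together
with `i`, and rejects the others. -/
def SPDAState.apply [DecidableEq I] [DecidableEq S] (C : S → Finset I → Finset I)
    (σ : SPDAState I S) (i : I) (s : S) : SPDAState I S where
  held := Function.update σ.held s (C s (insert i (σ.held s)))
  rejected j := {s' | s' ∈ σ.rejected j ∨
    (s' = s ∧ j ∈ insert i (σ.held s) ∧ j ∉ C s (insert i (σ.held s)))}

/-- A round: some active student applies to the best school that has not rejected the student. -/
def SPDAState.Round [DecidableEq I] [DecidableEq S] (C : S → Finset I → Finset I)
    (P : I → Preference S) (σ σ' : SPDAState I S) : Prop :=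
  ∃ i s, σ.Active P i ∧ s ∉ σ.rejected i ∧ (∀ s', s' ∉ σ.rejected i → (P i).R (some s) (some s')) ∧
    σ' = σ.apply C i s

variable {T : Type*}

/-- `μ` is the result of a complete run of the algorithm (in some order of applications). -/
def IsSPDAOutcome [Fintype I] [DecidableEq I] [DecidableEq S] {M : Market I S T}
    (C : S → Finset I → Finset I) (P : I → Preference S) (μ : M.Matching) : Prop :=
  ∃ σ : SPDAState I S, Relation.ReflTransGen (SPDAState.Round C P) (SPDAState.init I S) σ ∧
    (∀ i, ¬ σ.Active P i) ∧ ∀ s, μ.at s = σ.held s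

/-- `φ` is a deferred acceptance mechanism for the choice functions derived from the priorities. -/
def IsPhiBar [Fintype I] [DecidableEq I] [DecidableEq S] [Fintype T] {M : Market I S T}
    (L : M.Labelling) (φ : (I → Preference S) → M.Matching) : Prop :=
  ∀ P, IsSPDAOutcome (Market.choice L) P (φ P)

end DeferredAcceptance

/-! Although the priorities of a school depend on who is assigned, they determine exactly one stable
selection from each set of applicants. Existence comes from the construction of `choice`, whose held
set remains a stable selection after every arrival (`stableSet_choice`). Uniqueness
(`StableSet.unique`) rests on linearity: PD forces two stable selections to have equal type counts,
and WO then makes them agree within each type. Hence a matching is stable exactly when it is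
acceptable to the students and each school chooses its assigned students from all who weakly prefer
it to their assignment (`stable_iff_choiceStable`).

These choice functions are substitutable, independent of rejected students, and satisfy the law of
aggregate demand. Independence follows from uniqueness. For the other two it suffices to exhibit,
for an arbitrary newcomer, a stable selection that lies in the old one plus the newcomer and is no
smaller (`StableSet.exists_insert`); uniqueness identifies it with the choice. DC makes pairwise
comparisons within a set transitive (`Regular.trans_erase`), so that a lowest student exists.

Under these properties deferred acceptance never takes from a student a school that some stable
matching assigns to that student, which gives optimality. For group strategy-proofness
(`IsSPDAOutcome.not_exists_improvement`), let the improvers keep their truthful outcome and all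
others the manipulated one. This hybrid fills as many seats at each school as the manipulated
outcome. At the round that completes the placement of the improvers at their truthful schools, the
law of aggregate demand asks for one student more than the hybrid supplies. -/

namespace Market

variable {I S T : Type*}

/-! ### Consequences of PD, WO and DC at a single school -/

theorem available_none (J : Finset I) : Available J none := by
  intro i _ h; cases h

theorem available_some {J : Finset I} {i : I} (hi : i ∉ J) : Available J (some i) := by
  intro j hj h; cases h; exact hi hj

section TypeCount

variable [DecidableEq T] {M : Market I S T} {s : S}

theorem typeCount_type_none (J : Finset I) : M.typeCount s J (M.type s none) = 0 := by
  unfold typeCount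
  rw [Finset.card_eq_zero, Finset.filter_eq_empty_iff]
  exact fun i _ h => M.type_none_ne s i h.symm

theorem sum_typeCount [Fintype T] (J : Finset I) : ∑ t, M.typeCount s J t = J.card :=
  (Finset.card_eq_sum_card_fiberwise (fun _ _ => Finset.mem_coe.2 (Finset.mem_univ _))).symm

theorem typeCount_insert [DecidableEq I] {J : Finset I} {a : I} (ha : a ∉ J) (t : T) :
    M.typeCount s (insert a J) t =
      M.typeCount s J t + if M.type s (some a) = t then 1 else 0 := by
  unfold typeCount
  rw [Finset.filter_insert]
  split_ifs with h
  · rw [Finset.card_insert_of_notMem (by simp [ha])]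
  · rfl

theorem typeCount_erase [DecidableEq I] {J : Finset I} {a : I} (ha : a ∈ J) (t : T) :
    M.typeCount s J t =
      M.typeCount s (J.erase a) t + if M.type s (some a) = t then 1 else 0 := by
  conv_lhs => rw [← Finset.insert_erase ha]
  exact typeCount_insert (Finset.notMem_erase a J) t

end TypeCount

/-- The standing assumptions on a single school: PD, WO, DC and antisymmetry. -/
structure Regular [DecidableEq I] [DecidableEq T] (M : Market I S T) (s : S) : Prop where
  pd : M.PD s
  wo : M.WO s
  dc : M.DC s
  lin : M.LinearPriorities s

namespace Regular

variable [DecidableEq I] [DecidableEq T] {M : Market I S T} {s : S}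

theorem antisymm (h : M.Regular s) {J : Finset I} {i j : I} (hJ : J.card < M.q s) (hi : i ∉ J)
    (hj : j ∉ J) (hij : i ≠ j) (h1 : M.prio s J (some i) (some j)) :
    ¬ M.prio s J (some j) (some i) := fun h2 =>
  hij (Option.some.inj (h.lin J hJ _ _ (available_some hi) (available_some hj) h1 h2))

theorem antisymm_none (h : M.Regular s) {J : Finset I} {i : I} (hJ : J.card < M.q s) (hi : i ∉ J)
    (h1 : M.prio s J (some i) none) : ¬ M.prio s J none (some i) := fun h2 =>
  Option.some_ne_none i (h.lin J hJ _ _ (available_some hi) (available_none J) h1 h2)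

theorem total (_ : M.Regular s) {J : Finset I} {i j : I} (hJ : J.card < M.q s) (hi : i ∉ J)
    (hj : j ∉ J) (h1 : ¬ M.prio s J (some j) (some i)) : M.prio s J (some i) (some j) :=
  (M.prio_total s J hJ _ _ (available_some hi) (available_some hj)).resolve_right h1

theorem trans (_ : M.Regular s) {J : Finset I} {i j k : I} (hJ : J.card < M.q s) (hi : i ∉ J)
    (hj : j ∉ J) (hk : k ∉ J) (h1 : M.prio s J (some i) (some j))
    (h2 : M.prio s J (some j) (some k)) : M.prio s J (some i) (some k) :=
  M.prio_trans s J hJ _ _ _ (available_some hi) (available_some hj) (available_some hk) h1 h2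

theorem trans_none (_ : M.Regular s) {J : Finset I} {i j : I} (hJ : J.card < M.q s) (hi : i ∉ J)
    (hj : j ∉ J) (h1 : M.prio s J (some i) (some j)) (h2 : M.prio s J (some j) none) :
    M.prio s J (some i) none :=
  M.prio_trans s J hJ _ _ _ (available_some hi) (available_some hj) (available_none J) h1 h2

/-- The outside option separates the two students. This is the usual source of fairness between
students of different types while a seat is free. -/
theorem prio_of_accept (h : M.Regular s) {J : Finset I} {i j : I} (hJ : J.card < M.q s)
    (hi : i ∉ J) (hj : j ∉ J) (h1 : M.prio s J (some i) none) (h2 : ¬ M.prio s J (some j) none) :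
    M.prio s J (some i) (some j) :=
  h.total hJ hi hj fun h3 => h2 (h.trans_none hJ hj hi h3 h1)

theorem transfer (h : M.Regular s) {J J' : Finset I} {i j : I} (hJ : J.card < M.q s)
    (hJ' : J'.card < M.q s) (hi : i ∉ J) (hj : j ∉ J) (hi' : i ∉ J') (hj' : j ∉ J')
    (h1 : M.typeCount s J' (M.type s (some i)) ≤ M.typeCount s J (M.type s (some i)))
    (h2 : M.typeCount s J (M.type s (some j)) ≤ M.typeCount s J' (M.type s (some j)))
    (h3 : M.prio s J (some i) (some j)) : M.prio s J' (some i) (some j) :=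
  (h.pd _ _ J J' hJ hJ' (available_some hi) (available_some hj) (available_some hi')
    (available_some hj') h1 h2).2 h3

/-- No student has the type of `∅`, so the count condition of PD for `∅` reads `0 ≤ 0` and only the
type of `i` matters. -/
theorem transfer_none (h : M.Regular s) {J J' : Finset I} {i : I} (hJ : J.card < M.q s)
    (hJ' : J'.card < M.q s) (hi : i ∉ J) (hi' : i ∉ J')
    (h1 : M.typeCount s J' (M.type s (some i)) ≤ M.typeCount s J (M.type s (some i)))
    (h3 : M.prio s J (some i) none) : M.prio s J' (some i) none :=
  (h.pd _ _ J J' hJ hJ' (available_some hi) (available_none J) (available_some hi')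
    (available_none J') h1 (by simp only [typeCount_type_none, le_refl])).2 h3

theorem within (h : M.Regular s) {J J' : Finset I} {i j : I} (hJ : J.card < M.q s)
    (hJ' : J'.card < M.q s) (hi : i ∉ J) (hj : j ∉ J) (hi' : i ∉ J') (hj' : j ∉ J')
    (ht : M.type s (some i) = M.type s (some j))
    (h3 : M.prio s J (some i) (some j)) : M.prio s J' (some i) (some j) :=
  (h.wo _ _ J J' hJ hJ' (available_some hi) (available_some hj) (available_some hi')
    (available_some hj') ht).2 h3

theorem swap_left (h : M.Regular s) {J : Finset I} {i j k : I} (hJ : J.card + 1 < M.q s)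
    (hij : i ≠ j) (hik : i ≠ k) (hjk : j ≠ k) (hi : i ∉ J) (hj : j ∉ J) (hk : k ∉ J)
    (ht : M.type s (some i) = M.type s (some j)) (h1 : M.prio s J (some i) (some j))
    (h2 : M.prio s (insert i J) (some j) (some k)) :
    M.prio s (insert j J) (some i) (some k) := by
  have hc : (insert i J).card < M.q s := by rw [Finset.card_insert_of_notMem hi]; exact hJ
  have hk' : k ∉ insert i J := by simp [hk, hik.symm]
  have hj' : j ∉ insert i J := by simp [hj, hij.symm]
  exact ((h.dc i j (some k) J hJ hij hi hj (available_some hk) (by simpa using hik.symm)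
    (by simpa using hjk.symm) ht h1).1 ⟨h2, h.antisymm hc hj' hk' hjk h2⟩).1

theorem swap_right (h : M.Regular s) {J : Finset I} {i j k : I} (hJ : J.card + 1 < M.q s)
    (hij : i ≠ j) (hik : i ≠ k) (hjk : j ≠ k) (hi : i ∉ J) (hj : j ∉ J) (hk : k ∉ J)
    (ht : M.type s (some i) = M.type s (some j)) (h1 : M.prio s J (some i) (some j))
    (h2 : M.prio s (insert j J) (some k) (some i)) :
    M.prio s (insert i J) (some k) (some j) := by
  have hc : (insert j J).card < M.q s := by rw [Finset.card_insert_of_notMem hj]; exact hJ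
  have hk' : k ∉ insert j J := by simp [hk, hjk.symm]
  have hi' : i ∉ insert j J := by simp [hi, hij]
  exact ((h.dc i j (some k) J hJ hij hi hj (available_some hk) (by simpa using hik.symm)
    (by simpa using hjk.symm) ht h1).2.2 ⟨h2, h.antisymm hc hk' hi' hik.symm h2⟩).1

theorem swap_none (h : M.Regular s) {J : Finset I} {i j : I} (hJ : J.card + 1 < M.q s)
    (hij : i ≠ j) (hi : i ∉ J) (hj : j ∉ J)
    (ht : M.type s (some i) = M.type s (some j)) (h1 : M.prio s J (some i) (some j))
    (h2 : M.prio s (insert i J) (some j) none) : M.prio s (insert j J) (some i) none := by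
  have hc : (insert i J).card < M.q s := by rw [Finset.card_insert_of_notMem hi]; exact hJ
  have hj' : j ∉ insert i J := by simp [hj, hij.symm]
  exact ((h.dc i j none J hJ hij hi hj (available_none J) (by simp) (by simp) ht h1).1
    ⟨h2, h.antisymm_none hc hj' h2⟩).1

/-- Pairwise comparisons within a set `K`, each made given the rest of `K`, are transitive. -/
theorem trans_erase (h : M.Regular s) {K : Finset I} (hK : K.card ≤ M.q s + 1) {a b c : I}
    (ha : a ∈ K) (hb : b ∈ K) (hc : c ∈ K) (hab : a ≠ b) (hbc : b ≠ c) (hac : a ≠ c)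
    (h1 : M.prio s ((K.erase a).erase b) (some a) (some b))
    (h2 : M.prio s ((K.erase b).erase c) (some b) (some c)) :
    M.prio s ((K.erase a).erase c) (some a) (some c) := by
  -- With the common part `J` split off, the three comparisons are made given `J ∪ {c}`, `J ∪ {a}`
  -- and `J ∪ {b}`.
  obtain ⟨J, haJ, hbJ, hcJ, rfl⟩ : ∃ J : Finset I, a ∉ J ∧ b ∉ J ∧ c ∉ J ∧
      K = insert a (insert b (insert c J)) :=
    ⟨((K.erase a).erase b).erase c, by simp, by simp, by simp, by
      ext x; simp only [Finset.mem_insert, Finset.mem_erase]; grind⟩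
  have e1 : ((insert a (insert b (insert c J))).erase a).erase b = insert c J := by
    ext x; simp only [Finset.mem_insert, Finset.mem_erase]; grind
  have e2 : ((insert a (insert b (insert c J))).erase b).erase c = insert a J := by
    ext x; simp only [Finset.mem_insert, Finset.mem_erase]; grind
  have e3 : ((insert a (insert b (insert c J))).erase a).erase c = insert b J := by
    ext x; simp only [Finset.mem_insert, Finset.mem_erase]; grind
  rw [e1] at h1; rw [e2] at h2; rw [e3]
  have hcard : J.card + 1 < M.q s := by
    rw [Finset.card_insert_of_notMem (by simp [*]), Finset.card_insert_of_notMem (by simp [*]),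
      Finset.card_insert_of_notMem hcJ] at hK
    omega
  have hJ : J.card < M.q s := by omega
  have hJc : (insert c J).card < M.q s := by rw [Finset.card_insert_of_notMem hcJ]; exact hcard
  have hJa : (insert a J).card < M.q s := by rw [Finset.card_insert_of_notMem haJ]; exact hcard
  have hJb : (insert b J).card < M.q s := by rw [Finset.card_insert_of_notMem hbJ]; exact hcard
  have hac' : a ∉ insert c J := by simp [*]
  have hbc' : b ∉ insert c J := by simp [hbc, hbJ]
  have hba' : b ∉ insert a J := by simp [hab.symm, hbJ]
  have hca' : c ∉ insert a J := by simp [hac.symm, hcJ]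
  have hab' : a ∉ insert b J := by simp [hab, haJ]
  have hcb' : c ∉ insert b J := by simp [hbc.symm, hcJ]
  by_cases tab : M.type s (some a) = M.type s (some b)
  · exact h.swap_left hcard hab hac hbc haJ hbJ hcJ tab
      (h.within hJc hJ hac' hbc' haJ hbJ tab h1) h2
  by_cases tbc : M.type s (some b) = M.type s (some c)
  · exact h.swap_right hcard hbc hab.symm hac.symm hbJ hcJ haJ tbc
      (h.within hJa hJ hba' hca' hbJ hcJ tbc h2) h1
  -- If `c` beat `a`, DC for the pair `c`, `a` against `b` would turn `a ≿ b` into `c ≿ b` given `J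
  -- ∪ {a}`, contrary to `b ≿ c` there.
  by_cases tac : M.type s (some a) = M.type s (some c)
  · by_contra h3
    have h4 := h.total hJb hcb' hab' h3
    have h5 := h.swap_left hcard hac.symm hbc.symm hab hcJ haJ hbJ tac.symm
      (h.within hJb hJ hcb' hab' hcJ haJ tac.symm h4) h1
    exact h.antisymm hJa hba' hca' hbc h2 h5
  -- For three distinct types PD moves both comparisons to the common set `J`, where the order is
  -- transitive, and the result to `J ∪ {b}`.
  · have h1' : M.prio s J (some a) (some b) := by
      refine h.transfer hJc hJ hac' hbc' haJ hbJ ?_ ?_ h1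
      · rw [typeCount_insert hcJ]; omega
      · rw [typeCount_insert hcJ, if_neg (fun e => tbc e.symm)]; omega
    have h2' : M.prio s J (some b) (some c) := by
      refine h.transfer hJa hJ hba' hca' hbJ hcJ ?_ ?_ h2
      · rw [typeCount_insert haJ]; omega
      · rw [typeCount_insert haJ, if_neg tac]; omega
    refine h.transfer hJ hJb haJ hcJ hab' hcb' ?_ ?_ (h.trans hJ haJ hbJ hcJ h1' h2')
    · rw [typeCount_insert hbJ, if_neg (fun e => tab e.symm)]; omega
    · rw [typeCount_insert hbJ]; omega

end Regular

/-- Transitivity is asked only of distinct triples, so the lemma also covers comparisons of `i` and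
`j` given `K \ {i, j}`, which do not come from a single priority order. -/
theorem exists_least_of_total {r : I → I → Prop} (K : Finset I) (hK : K.Nonempty)
    (htot : ∀ i ∈ K, ∀ j ∈ K, i ≠ j → r i j ∨ r j i)
    (htr : ∀ i ∈ K, ∀ j ∈ K, ∀ k ∈ K, i ≠ j → j ≠ k → i ≠ k → r i j → r j k → r i k) :
    ∃ m ∈ K, ∀ j ∈ K, j ≠ m → r j m := by
  classical
  induction hK using Finset.Nonempty.cons_induction with
  | singleton a => exact ⟨a, by simp, by simp⟩
  | cons a K ha _ ih =>
    simp only [Finset.mem_cons] at *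
    obtain ⟨m, hm, hmin⟩ := ih (fun i hi j hj => htot i (Or.inr hi) j (Or.inr hj))
      (fun i hi j hj k hk => htr i (Or.inr hi) j (Or.inr hj) k (Or.inr hk))
    have ham : a ≠ m := fun e => ha (e ▸ hm)
    rcases htot a (Or.inl rfl) m (Or.inr hm) ham with h | h
    · exact ⟨m, Or.inr hm, fun j hj hjm => hj.elim (fun e => e ▸ h) (fun hj => hmin j hj hjm)⟩
    · refine ⟨a, Or.inl rfl, fun j hj hja => ?_⟩
      have hj := hj.resolve_left hja
      by_cases hjm : j = m
      · exact hjm ▸ h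
      · exact htr j (Or.inr hj) m (Or.inr hm) a (Or.inl rfl) hjm (Ne.symm ham) hja (hmin j hj hjm) h

end Market

/-! ### Stable selections and their uniqueness -/

namespace Market

variable {I S T : Type*}

/-- `K` is a stable selection from the applicants `J` of school `s`: it respects the capacity, all
its members are acceptable, no rejected applicant has justified envy, and no seat is wasted. -/
structure StableSet [DecidableEq I] (M : Market I S T) (s : S) (J K : Finset I) : Prop where
  subset : K ⊆ J
  card_le : K.card ≤ M.q s
  acceptable : ∀ i ∈ K, M.prio s (K.erase i) (some i) none
  fair : ∀ i ∈ J, i ∉ K → ∀ j ∈ K, M.prio s (K.erase j) (some j) (some i)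
  nonwasteful : ∀ i ∈ J, i ∉ K → K.card < M.q s → ¬ M.prio s K (some i) none

namespace StableSet

variable [DecidableEq I] {M : Market I S T} {s : S} {J K K' : Finset I}

/-- Deleting rejected applicants only removes conditions. Combined with uniqueness this is
independence of rejected students. -/
theorem mono {J' : Finset I} (h : M.StableSet s J' K) (hK : K ⊆ J) (hJ : J ⊆ J') :
    M.StableSet s J K :=
  ⟨hK, h.card_le, h.acceptable, fun i hi => h.fair i (hJ hi), fun i hi => h.nonwasteful i (hJ hi)⟩

theorem card_erase_lt (h : M.StableSet s J K) {i : I} (hi : i ∈ K) :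
    (K.erase i).card < M.q s :=
  (Finset.card_erase_lt_of_mem hi).trans_le h.card_le

theorem empty : M.StableSet s ∅ ∅ :=
  ⟨Finset.Subset.refl _, Nat.zero_le _, by simp, by simp, by simp⟩

variable [DecidableEq T]

/-- If `K` has more students of one type, take such an `i` in `K \ K'`. A free seat in `K'` would be
wasted on `i`, so `K'` is full and has more students of another type, among them some `j` outside
`K`. Fairness of `K` and of `K'` ranks `i` and `j` in opposite ways, and PD brings both rankings to
the same set. -/
theorem typeCount_le [Fintype T] (h : M.Regular s) (hK : M.StableSet s J K)
    (hK' : M.StableSet s J K') (t : T) : M.typeCount s K t ≤ M.typeCount s K' t := by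
  by_contra! hlt
  obtain ⟨i, hi, hi'⟩ := Finset.exists_mem_notMem_of_card_lt_card hlt
  simp only [Finset.mem_filter, not_and] at hi hi'
  obtain ⟨hiK, rfl⟩ := hi
  have hiK' : i ∉ K' := fun e => hi' e rfl
  have hci := typeCount_erase (M := M) (s := s) hiK (M.type s (some i))
  rw [if_pos rfl] at hci
  have hfull : ¬ K'.card < M.q s := fun hc =>
    hK'.nonwasteful i (hK.subset hiK) hiK' hc
      (h.transfer_none (hK.card_erase_lt hiK) hc (by simp) hiK' (by omega) (hK.acceptable i hiK))
  obtain ⟨t, ht⟩ : ∃ t, M.typeCount s K t < M.typeCount s K' t := by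
    by_contra! hall
    have : ∑ t, M.typeCount s K' t < ∑ t, M.typeCount s K t :=
      Finset.sum_lt_sum (fun t _ => hall t) ⟨_, Finset.mem_univ _, hlt⟩
    rw [sum_typeCount, sum_typeCount] at this
    have := hK.card_le
    omega
  obtain ⟨j, hj, hj'⟩ := Finset.exists_mem_notMem_of_card_lt_card ht
  simp only [Finset.mem_filter, not_and] at hj hj'
  obtain ⟨hjK', rfl⟩ := hj
  have hjK : j ∉ K := fun e => hj' e rfl
  have hcj := typeCount_erase (M := M) (s := s) hjK' (M.type s (some j))
  have hcj' := typeCount_erase (M := M) (s := s) hjK' (M.type s (some i))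
  have hci' := typeCount_erase (M := M) (s := s) hiK (M.type s (some j))
  rw [if_pos rfl] at hcj
  have hij : i ≠ j := fun e => hjK (e ▸ hiK)
  have h1 := hK.fair j (hK'.subset hjK') hjK i hiK
  have h2 := hK'.fair i (hK.subset hiK) hiK' j hjK'
  refine h.antisymm (hK'.card_erase_lt hjK') (by simp) (by simp [hiK']) hij.symm h2 ?_
  exact h.transfer (hK.card_erase_lt hiK) (hK'.card_erase_lt hjK') (by simp) (by simp [hjK])
    (by simp [hiK']) (by simp) (by omega) (by omega) h1

/-- Equal type counts pair a student of `K \ K'` with one of the same type in `K' \ K`. Fairness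
ranks them in opposite ways, which WO and antisymmetry exclude. -/
theorem unique [Fintype T] (h : M.Regular s) (hK : M.StableSet s J K)
    (hK' : M.StableSet s J K') : K = K' := by
  have hcount (t : T) : M.typeCount s K t = M.typeCount s K' t :=
    le_antisymm (typeCount_le h hK hK' t) (typeCount_le h hK' hK t)
  have hsub : K ⊆ K' := by
    intro i hi
    by_contra hi'
    obtain ⟨j, hj, hj'⟩ : ∃ j ∈ K'.filter (fun j => M.type s (some j) = M.type s (some i)),
        j ∉ K.filter (fun j => M.type s (some j) = M.type s (some i)) := by
      by_contra! hall
      have := Finset.eq_of_subset_of_card_le hall (hcount (M.type s (some i))).le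
      have hmem : i ∈ K.filter (fun j => M.type s (some j) = M.type s (some i)) := by simp [hi]
      rw [← this] at hmem
      exact hi' (Finset.mem_filter.1 hmem).1
    simp only [Finset.mem_filter, not_and] at hj hj'
    have hjK : j ∉ K := fun e => hj' e hj.2
    have hij : i ≠ j := fun e => hjK (e ▸ hi)
    refine h.antisymm (hK.card_erase_lt hi) (by simp) (by simp [hjK]) hij
      (hK.fair j (hK'.subset hj.1) hjK i hi) ?_
    exact h.within (hK'.card_erase_lt hj.1) (hK.card_erase_lt hi) (by simp) (by simp [hi'])
      (by simp [hjK]) (by simp) hj.2 (hK'.fair i (hK.subset hi) hi' j hj.1)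
  refine Finset.eq_of_subset_of_card_le hsub ?_
  rw [← sum_typeCount (M := M) (s := s) K, ← sum_typeCount (M := M) (s := s) K']
  exact Finset.sum_le_sum fun t _ => (hcount t).ge

end StableSet
end Market

/-! ### The effect of a newcomer on a stable selection -/

namespace Market

variable {I S T : Type*}

/-- Pairwise comparisons are transitive by `trans_erase`, so a bottom element exists. The bound `q +
1` is what keeps `K` minus two students within the range where priorities are defined. -/
theorem Regular.exists_lowest [DecidableEq I] [DecidableEq T] {M : Market I S T} {s : S}
    (h : M.Regular s) {K : Finset I} (hne : K.Nonempty) (hK : K.card ≤ M.q s + 1) :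
    ∃ r ∈ K, ∀ j ∈ K, j ≠ r → M.prio s ((K.erase r).erase j) (some j) (some r) := by
  have hcard {i j : I} (hi : i ∈ K) (hj : j ∈ K) (hij : i ≠ j) :
      ((K.erase i).erase j).card < M.q s := by
    have h1 := Finset.card_erase_add_one hi
    have h2 := Finset.card_erase_add_one (Finset.mem_erase.2 ⟨hij.symm, hj⟩)
    omega
  obtain ⟨r, hr, hmin⟩ := exists_least_of_total
    (r := fun i j => M.prio s ((K.erase i).erase j) (some i) (some j)) K hne
    (fun i hi j hj hij => by
      rw [Finset.erase_right_comm (a := j) (b := i)]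
      exact M.prio_total s _ (hcard hi hj hij) _ _ (available_some (by simp))
        (available_some (by simp)))
    (fun i hi j hj k hk hij hjk hik => h.trans_erase hK hi hj hk hij hjk hik)
  exact ⟨r, hr, fun j hj hjr => by rw [Finset.erase_right_comm]; exact hmin j hj hjr⟩

namespace StableSet

variable [DecidableEq I] {M : Market I S T} {s : S} {J K B : Finset I} {a r : I}

theorem insert_right (hK : M.StableSet s J K)
    (hfair : ∀ j ∈ K, M.prio s (K.erase j) (some j) (some a))
    (hnw : K.card < M.q s → ¬ M.prio s K (some a) none) : M.StableSet s (insert a J) K where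
  subset := hK.subset.trans (Finset.subset_insert _ _)
  card_le := hK.card_le
  acceptable := hK.acceptable
  fair i hi hiK j hj := by
    rcases Finset.mem_insert.1 hi with rfl | hi
    · exact hfair j hj
    · exact hK.fair i hi hiK j hj
  nonwasteful i hi hiK hc := by
    rcases Finset.mem_insert.1 hi with rfl | hi
    · exact hnw hc
    · exact hK.nonwasteful i hi hiK hc

variable [DecidableEq T]

/-- The newcomer `a` is kept when a seat is free and the lowest student `r` of the type of `a`
remains acceptable. -/
theorem insert_insert (h : M.Regular s) (hK : M.StableSet s J K) (ha : a ∉ J)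
    (hc : K.card < M.q s) (hr : r ∈ insert a K) (hra : M.type s (some r) = M.type s (some a))
    (hmin : ∀ i ∈ insert a K, i ≠ r → M.type s (some i) = M.type s (some r) →
      M.prio s ∅ (some i) (some r))
    (hacc : M.prio s ((insert a K).erase r) (some r) none) :
    M.StableSet s (insert a J) (insert a K) := by
  have haK : a ∉ K := fun e => ha (hK.subset e)
  have hq : (∅ : Finset I).card < M.q s := M.q_pos s
  have hcard : (insert a K).card = K.card + 1 := Finset.card_insert_of_notMem haK
  have herase {x : I} (hx : x ∈ insert a K) : ((insert a K).erase x).card < M.q s := by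
    rw [Finset.card_erase_of_mem hx]; omega
  have hKj {j : I} (hj : j ∈ K) : (insert a K).erase j = insert a (K.erase j) :=
    Finset.erase_insert_of_ne (fun e => haK (e ▸ hj))
  have hacc' : ∀ i ∈ insert a K, M.prio s ((insert a K).erase i) (some i) none := by
    intro i hi
    by_cases hir : i = r
    · rw [hir]; exact hacc
    by_cases ht : M.type s (some i) = M.type s (some r)
    -- Since `i` is above `r` within their type, DC turns acceptability of `r` without `r` into
    -- acceptability of `i` without `i`.
    · have e1 : insert i (((insert a K).erase i).erase r) = (insert a K).erase r := by
        ext x; simp only [Finset.mem_insert, Finset.mem_erase]; grind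
      have e2 : insert r (((insert a K).erase i).erase r) = (insert a K).erase i :=
        Finset.insert_erase (Finset.mem_erase.2 ⟨Ne.symm hir, hr⟩)
      have hJ : (((insert a K).erase i).erase r).card + 1 < M.q s := by
        have h1 := Finset.card_erase_add_one (Finset.mem_erase.2 ⟨Ne.symm hir, hr⟩)
        have h2 := Finset.card_erase_add_one hi
        omega
      have := h.swap_none hJ hir (by simp) (by simp) ht
        (h.within hq (by omega) (by simp) (by simp) (by simp) (by simp) ht (hmin i hi hir ht))
        (by rw [e1]; exact hacc)
      rwa [e2] at this
    · have hia : i ≠ a := fun e => ht (by rw [e, hra])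
      have hiK := (Finset.mem_insert.1 hi).resolve_left hia
      refine h.transfer_none (hK.card_erase_lt hiK) (herase hi) (by simp) (by simp) ?_
        (hK.acceptable i hiK)
      rw [hKj hiK, typeCount_insert (by simp [haK]), if_neg (fun e => ht (by rw [hra, e]))]
      omega
  refine ⟨Finset.insert_subset_insert a hK.subset, by omega, hacc', ?_, ?_⟩
  · intro i hi hiK j hj
    have hia : i ≠ a := fun e => hiK (e ▸ Finset.mem_insert_self a K)
    replace hi := (Finset.mem_insert.1 hi).resolve_left hia
    -- A seat was free, so a rejected `i` was already unacceptable given `K`; PD keeps it so where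
    -- the count of its type has not fallen.
    have hiK' : i ∉ K := fun e => hiK (Finset.mem_insert_of_mem e)
    have hni := hK.nonwasteful i hi hiK' hc
    by_cases hja : j = a
    · have hj1 := hacc' j hj
      rw [hja, Finset.erase_insert haK] at hj1 ⊢
      exact h.prio_of_accept hc haK hiK' hj1 hni
    have hjK := (Finset.mem_insert.1 hj).resolve_left hja
    have hi1 : i ∉ (insert a K).erase j := fun e => hiK (Finset.mem_of_mem_erase e)
    by_cases ht : M.type s (some j) = M.type s (some i)
    · exact h.within (hK.card_erase_lt hjK) (herase hj) (by simp) (by simp [hiK']) (by simp) hi1 ht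
        (hK.fair i hi hiK' j hjK)
    · refine h.prio_of_accept (herase hj) (by simp) hi1 (hacc' j hj) fun h1 => hni ?_
      refine h.transfer_none (herase hj) hc hi1 hiK' ?_ h1
      rw [typeCount_erase hjK, if_neg ht, hKj hjK, typeCount_insert (by simp [haK])]
      omega
  · intro i hi hiK hc' h1
    have hia : i ≠ a := fun e => hiK (e ▸ Finset.mem_insert_self a K)
    replace hi := (Finset.mem_insert.1 hi).resolve_left hia
    have hiK' : i ∉ K := fun e => hiK (Finset.mem_insert_of_mem e)
    refine hK.nonwasteful i hi hiK' hc (h.transfer_none hc' hc hiK hiK' ?_ h1)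
    rw [typeCount_insert haK]; omega

/-- The newcomer `a` replaces `r`, the lowest student of the type of `a`, when a seat is free but
`r` is no longer acceptable. -/
theorem replace_of_lt (h : M.Regular s) (hK : M.StableSet s J (insert r B)) (hrB : r ∉ B)
    (ha : a ∉ J) (hc : (insert r B).card < M.q s)
    (hra : M.type s (some r) = M.type s (some a))
    (hmin : ∀ i ∈ insert a B, M.type s (some i) = M.type s (some r) →
      M.prio s ∅ (some i) (some r))
    (hacc : ¬ M.prio s (insert a B) (some r) none) :
    M.StableSet s (insert a J) (insert a B) := by
  have haK : a ∉ insert r B := fun e => ha (hK.subset e)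
  have har : a ≠ r := fun e => haK (e ▸ Finset.mem_insert_self r B)
  have haB : a ∉ B := fun e => haK (Finset.mem_insert_of_mem e)
  have hq : (∅ : Finset I).card < M.q s := M.q_pos s
  have hcard : (insert a B).card = (insert r B).card := by
    rw [Finset.card_insert_of_notMem haB, Finset.card_insert_of_notMem hrB]
  have hB : B.card < M.q s := by rw [Finset.card_insert_of_notMem hrB] at hc; omega
  have hc' : (insert a B).card < M.q s := hcard ▸ hc
  have herase (x : I) : ((insert a B).erase x).card < M.q s :=
    (Finset.card_le_card (Finset.erase_subset _ _)).trans_lt hc'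
  have hBr : (insert r B).erase r = B := Finset.erase_insert hrB
  have hBa : (insert a B).erase a = B := Finset.erase_insert haB
  have hrj {j : I} (hj : j ∈ B) : (insert r B).erase j = insert r (B.erase j) :=
    Finset.erase_insert_of_ne (fun e => hrB (e ▸ hj))
  have haj {j : I} (hj : j ∈ B) : (insert a B).erase j = insert a (B.erase j) :=
    Finset.erase_insert_of_ne (fun e => haB (e ▸ hj))
  have har' : M.prio s B (some a) (some r) :=
    h.within hq hB (by simp) (by simp) haB hrB hra.symm (hmin a (by simp) hra.symm)
  -- The exchanged students share a type, so no type count changes and PD carries over what held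
  -- before.
  have hcount (t : T) {D : Finset I} (h1 : a ∉ D) (h2 : r ∉ D) :
      M.typeCount s (insert a D) t = M.typeCount s (insert r D) t := by
    rw [typeCount_insert h1, typeCount_insert h2, hra]
  have hacc' : ∀ i ∈ insert a B, M.prio s ((insert a B).erase i) (some i) none := by
    intro i hi
    rcases Finset.mem_insert.1 hi with rfl | hi'
    · have := hK.acceptable r (by simp)
      rw [hBr] at this
      rw [hBa]
      exact h.trans_none hB haB hrB har' this
    · have hiK := Finset.mem_insert_of_mem (a := i) (b := r) hi'
      refine h.transfer_none (hK.card_erase_lt hiK) (herase i) (by simp) (by simp) ?_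
        (hK.acceptable i hiK)
      rw [hrj hi', haj hi', hcount _ (by simp [haB]) (by simp [hrB])]
  have hrK : r ∉ insert a B := by simp [hrB, har.symm]
  refine ⟨Finset.insert_subset_insert a ((Finset.subset_insert _ _).trans hK.subset), by omega,
    hacc', ?_, ?_⟩
  · intro i hi hiK j hj
    have hia : i ≠ a := fun e => hiK (e ▸ Finset.mem_insert_self a B)
    replace hi := (Finset.mem_insert.1 hi).resolve_left hia
    have hi1 (x : I) : i ∉ (insert a B).erase x := fun e => hiK (Finset.mem_of_mem_erase e)
    by_cases hir : i = r
    · subst hir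
      by_cases ht : M.type s (some j) = M.type s (some i)
      · exact h.within hq (herase j) (by simp) (by simp) (by simp) (hi1 j) ht (hmin j hj ht)
      · refine h.prio_of_accept (herase j) (by simp) (hi1 j) (hacc' j hj) fun h1 => hacc ?_
        refine h.transfer_none (herase j) hc' (hi1 j) hiK ?_ h1
        rw [typeCount_erase hj, if_neg ht]; omega
    · have hiB : i ∉ B := fun e => hiK (Finset.mem_insert_of_mem e)
      have hiK' : i ∉ insert r B := by simp [hir, hiB]
      rcases Finset.mem_insert.1 hj with rfl | hj'
      · have h1 := hK.fair i hi hiK' r (by simp)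
        rw [hBr] at h1
        rw [hBa]
        exact h.trans hB haB hrB hiB har' h1
      · have hjK := Finset.mem_insert_of_mem (a := j) (b := r) hj'
        have h1 := hK.fair i hi hiK' j hjK
        refine h.transfer (hK.card_erase_lt hjK) (herase j) (by simp)
          (fun e => hiK' (Finset.mem_of_mem_erase e)) (by simp) (hi1 j) ?_ ?_ h1 <;>
        rw [hrj hj', haj hj', hcount _ (by simp [haB]) (by simp [hrB])]
  · intro i hi hiK _ h1
    have hia : i ≠ a := fun e => hiK (e ▸ Finset.mem_insert_self a B)
    replace hi := (Finset.mem_insert.1 hi).resolve_left hia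
    by_cases hir : i = r
    · exact hacc (hir ▸ h1)
    · have hiK' : i ∉ insert r B := fun e =>
        hiK (Finset.mem_insert_of_mem ((Finset.mem_insert.1 e).resolve_left hir))
      refine hK.nonwasteful i hi hiK' hc (h.transfer_none hc' hc hiK hiK' ?_ h1)
      rw [hcount _ haB hrB]

/-- The newcomer `a` replaces `r`, the student of lowest priority, when all seats are taken. -/
theorem replace_of_full (h : M.Regular s) (hK : M.StableSet s J (insert r B)) (hrB : r ∉ B)
    (ha : a ∉ J) (hc : (insert r B).card = M.q s)
    (hmin : ∀ j ∈ insert a B, M.prio s ((insert a B).erase j) (some j) (some r)) :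
    M.StableSet s (insert a J) (insert a B) := by
  have haK : a ∉ insert r B := fun e => ha (hK.subset e)
  have har : a ≠ r := fun e => haK (e ▸ Finset.mem_insert_self r B)
  have haB : a ∉ B := fun e => haK (Finset.mem_insert_of_mem e)
  have hcard : (insert a B).card = (insert r B).card := by
    rw [Finset.card_insert_of_notMem haB, Finset.card_insert_of_notMem hrB]
  have hB : B.card < M.q s := by rw [Finset.card_insert_of_notMem hrB] at hc; omega
  have herase {x : I} (hx : x ∈ insert a B) : ((insert a B).erase x).card < M.q s := by
    rw [Finset.card_erase_of_mem hx]; have := M.q_pos s; omega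
  have hBr : (insert r B).erase r = B := Finset.erase_insert hrB
  have hBa : (insert a B).erase a = B := Finset.erase_insert haB
  have hrj {j : I} (hj : j ∈ B) : (insert r B).erase j = insert r (B.erase j) :=
    Finset.erase_insert_of_ne (fun e => hrB (e ▸ hj))
  have haj {j : I} (hj : j ∈ B) : (insert a B).erase j = insert a (B.erase j) :=
    Finset.erase_insert_of_ne (fun e => haB (e ▸ hj))
  have har' : M.prio s B (some a) (some r) := by
    have := hmin a (by simp)
    rwa [hBa] at this
  have hrK : r ∉ insert a B := by simp [hrB, har.symm]
  have hr1 (x : I) : r ∉ (insert a B).erase x := fun e => hrK (Finset.mem_of_mem_erase e)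
  have hcountr (t : T) {j : I} (hj : j ∈ B) : M.typeCount s ((insert r B).erase j) t =
      M.typeCount s (B.erase j) t + if M.type s (some r) = t then 1 else 0 := by
    rw [hrj hj, typeCount_insert (by simp [hrB])]
  have hcounta (t : T) {j : I} (hj : j ∈ B) : M.typeCount s ((insert a B).erase j) t =
      M.typeCount s (B.erase j) t + if M.type s (some a) = t then 1 else 0 := by
    rw [haj hj, typeCount_insert (by simp [haB])]
  have haccr := hK.acceptable r (by simp)
  rw [hBr] at haccr
  refine ⟨Finset.insert_subset_insert a ((Finset.subset_insert _ _).trans hK.subset), by omega,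
    ?_, ?_, fun i _ _ hlt => absurd hlt (by omega)⟩
  · intro i hi
    rcases Finset.mem_insert.1 hi with rfl | hi'
    · rw [hBa]
      exact h.trans_none hB haB hrB har' haccr
    have hiK := Finset.mem_insert_of_mem (a := i) (b := r) hi'
    -- The only case in which the count of the type of `i` rises. Then `i ≿ r ≿ ∅`, where the
    -- acceptability of `r` is inherited from `B`.
    by_cases hti : M.type s (some a) ≠ M.type s (some r) ∧
        M.type s (some a) = M.type s (some i)
    · refine h.trans_none (herase hi) (by simp) (hr1 i) (hmin i hi) ?_
      refine h.transfer_none hB (herase hi) hrB (hr1 i) ?_ haccr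
      rw [hcounta _ hi', if_neg hti.1, typeCount_erase hi']
      omega
    · refine h.transfer_none (hK.card_erase_lt hiK) (herase hi) (by simp) (by simp) ?_
        (hK.acceptable i hiK)
      rw [hcounta _ hi', hcountr _ hi']
      grind
  · intro i hi hiK j hj
    have hia : i ≠ a := fun e => hiK (e ▸ Finset.mem_insert_self a B)
    replace hi := (Finset.mem_insert.1 hi).resolve_left hia
    by_cases hir : i = r
    · rw [hir]; exact hmin j hj
    have hi1 (x : I) : i ∉ (insert a B).erase x := fun e => hiK (Finset.mem_of_mem_erase e)
    have hiB : i ∉ B := fun e => hiK (Finset.mem_insert_of_mem e)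
    have hiK' : i ∉ insert r B := by simp [hir, hiB]
    have hfr := hK.fair i hi hiK' r (by simp)
    rw [hBr] at hfr
    rcases Finset.mem_insert.1 hj with rfl | hj'
    · rw [hBa]
      exact h.trans hB haB hrB hiB har' hfr
    have hjK := Finset.mem_insert_of_mem (a := j) (b := r) hj'
    have hi2 : i ∉ (insert r B).erase j := fun e => hiK' (Finset.mem_of_mem_erase e)
    have hfj := hK.fair i hi hiK' j hjK
    by_cases tar : M.type s (some a) = M.type s (some r)
    · refine h.transfer (hK.card_erase_lt hjK) (herase hj) (by simp) hi2 (by simp) (hi1 j)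
        ?_ ?_ hfj <;>
      rw [hcounta _ hj', hcountr _ hj', tar]
    by_cases tji : M.type s (some j) = M.type s (some i)
    · exact h.within (hK.card_erase_lt hjK) (herase hj) (by simp) hi2 (by simp) (hi1 j) tji hfj
    -- Here the old comparison of `j` with `i` need not survive, so it is replaced by `j ≿ r ≿ i`:
    -- the first holds because `r` is lowest, the second by PD from fairness given `B`.
    · refine h.trans (herase hj) (by simp) (hr1 j) (hi1 j) (hmin j hj) ?_
      refine h.transfer hB (herase hj) hrB hiB (hr1 j) (hi1 j) ?_ ?_ hfr
      · rw [hcounta _ hj', if_neg tar, typeCount_erase hj']; omega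
      · rw [hcounta _ hj', typeCount_erase hj', if_neg tji]; omega

/-- When a newcomer arrives, a stable selection is obtained by adding the newcomer, dropping the
newcomer, or exchanging one of the current students for the newcomer. -/
theorem exists_insert (h : M.Regular s) (hK : M.StableSet s J K) (ha : a ∉ J) :
    ∃ K', M.StableSet s (insert a J) K' ∧ K' ⊆ insert a K ∧ K.card ≤ K'.card := by
  have haK : a ∉ K := fun e => ha (hK.subset e)
  have hq : (∅ : Finset I).card < M.q s := M.q_pos s
  rcases hK.card_le.lt_or_eq with hc | hc
  -- An arbitrary newcomer need not be last in the numbering, so the student at risk is the lowest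
  -- `r` of its type. By WO it can be found from the order given `∅`.
  · obtain ⟨r, hr, hmin⟩ := exists_least_of_total
      (r := fun i j => M.prio s ∅ (some i) (some j))
      ((insert a K).filter fun i => M.type s (some i) = M.type s (some a)) ⟨a, by simp⟩
      (fun i _ j _ _ => M.prio_total s ∅ hq _ _ (available_some (by simp)) (available_some (by simp)))
      (fun i _ j _ k _ _ _ _ => h.trans hq (by simp) (by simp) (by simp))
    obtain ⟨hr, hra⟩ := Finset.mem_filter.1 hr
    have hmin' : ∀ i ∈ insert a K, i ≠ r → M.type s (some i) = M.type s (some r) →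
        M.prio s ∅ (some i) (some r) := fun i hi hir ht =>
      hmin i (Finset.mem_filter.2 ⟨hi, ht.trans hra⟩) hir
    by_cases hacc : M.prio s ((insert a K).erase r) (some r) none
    · exact ⟨_, hK.insert_insert h ha hc hr hra hmin' hacc, Finset.Subset.refl _,
        Finset.card_le_card (Finset.subset_insert _ _)⟩
    by_cases hr' : r = a
    · subst hr'
      rw [Finset.erase_insert haK] at hacc
      refine ⟨K, hK.insert_right (fun j hj => ?_) fun _ => hacc, Finset.subset_insert _ _, le_rfl⟩
      have hjr : j ≠ r := fun e => haK (e ▸ hj)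
      have hcj := hK.card_erase_lt hj
      have hr1 : r ∉ K.erase j := fun e => haK (Finset.mem_of_mem_erase e)
      by_cases ht : M.type s (some j) = M.type s (some r)
      · exact h.within hq hcj (by simp) (by simp) (by simp) hr1 ht
          (hmin' j (Finset.mem_insert_of_mem hj) hjr ht)
      · refine h.prio_of_accept hcj (by simp) hr1 (hK.acceptable j hj) fun h1 => hacc ?_
        refine h.transfer_none hcj hc hr1 haK ?_ h1
        rw [typeCount_erase hj, if_neg ht]; omega
    · have hrK := (Finset.mem_insert.1 hr).resolve_left hr'
      obtain ⟨B, hrB, rfl⟩ : ∃ B, r ∉ B ∧ K = insert r B :=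
        ⟨K.erase r, by simp, (Finset.insert_erase hrK).symm⟩
      have e : (insert a (insert r B)).erase r = insert a B := by
        rw [Finset.erase_insert_of_ne (Ne.symm hr'), Finset.erase_insert hrB]
      rw [e] at hacc
      refine ⟨_, hK.replace_of_lt h hrB ha hc hra (fun i hi => hmin' i ?_ ?_) hacc, ?_, ?_⟩
      · exact Finset.insert_subset_insert _ (Finset.subset_insert _ _) hi
      · rintro rfl
        rw [← e] at hi
        simp at hi
      · exact Finset.insert_subset_insert _ (Finset.subset_insert _ _)
      · rw [Finset.card_insert_of_notMem hrB, Finset.card_insert_of_notMem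
          (fun e => haK (Finset.mem_insert_of_mem e))]
  · obtain ⟨r, hr, hmin⟩ := h.exists_lowest (K := insert a K) (by simp)
      (by rw [Finset.card_insert_of_notMem haK]; omega)
    by_cases hr' : r = a
    · subst hr'
      refine ⟨K, hK.insert_right (fun j hj => ?_) (by omega), Finset.subset_insert _ _, le_rfl⟩
      have := hmin j (Finset.mem_insert_of_mem hj) (fun e => haK (e ▸ hj))
      rwa [Finset.erase_insert haK] at this
    · have hrK := (Finset.mem_insert.1 hr).resolve_left hr'
      obtain ⟨B, hrB, rfl⟩ : ∃ B, r ∉ B ∧ K = insert r B :=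
        ⟨K.erase r, by simp, (Finset.insert_erase hrK).symm⟩
      have e : (insert a (insert r B)).erase r = insert a B := by
        rw [Finset.erase_insert_of_ne (Ne.symm hr'), Finset.erase_insert hrB]
      rw [e] at hmin
      refine ⟨_, hK.replace_of_full h hrB ha hc (fun i hi => hmin i ?_ ?_), ?_, ?_⟩
      · exact Finset.insert_subset_insert _ (Finset.subset_insert _ _) hi
      · rintro rfl
        rw [← e] at hi
        simp at hi
      · exact Finset.insert_subset_insert _ (Finset.subset_insert _ _)
      · rw [Finset.card_insert_of_notMem hrB, Finset.card_insert_of_notMem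
          (fun e => haK (Finset.mem_insert_of_mem e))]

end StableSet
end Market

/-! ### The derived choice functions as choice rules -/

/-- A choice function that is substitutable, independent of rejected students, and satisfies the
law of aggregate demand. -/
structure IsChoiceRule {I : Type*} (C : Finset I → Finset I) : Prop where
  subset : ∀ J, C J ⊆ J
  substitutes : ∀ {J J' a}, J ⊆ J' → a ∈ J → a ∈ C J' → a ∈ C J
  consistent : ∀ {J J'}, C J' ⊆ J → J ⊆ J' → C J = C J'
  aggregate_demand : ∀ {J J'}, J ⊆ J' → (C J).card ≤ (C J').card

namespace Market

variable {I S T : Type*}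

theorem sorted_pairwise [Fintype I] [DecidableEq I] [Fintype T] {M : Market I S T}
    (L : M.Labelling) (s : S) (J : Finset I) :
    (sorted L s J).Pairwise fun i j => L.num s i < L.num s j := by
  unfold sorted
  refine List.Pairwise.filter _ (List.pairwise_map.2 ?_)
  simpa using List.pairwise_lt_finRange _

theorem sorted_toFinset [Fintype I] [DecidableEq I] [Fintype T] {M : Market I S T}
    (L : M.Labelling) (s : S) (J : Finset I) : (sorted L s J).toFinset = J := by
  ext i
  simp only [sorted, List.mem_toFinset, List.mem_filter, List.mem_map, decide_eq_true_eq,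
    and_iff_right_iff_imp]
  exact fun _ => ⟨L.num s i, List.mem_finRange _, by simp⟩

section Choice

variable [Fintype I] [DecidableEq I] [Fintype T] [DecidableEq T] {M : Market I S T} {s : S}

/-- As `a` has the largest number so far, it is lowest within its type; with a seat free, its own
acceptability therefore decides whether it stays. -/
theorem StableSet.choiceStep (h : M.Regular s) (L : M.Labelling) {J K : Finset I} {a : I}
    (hK : M.StableSet s J K) (hlt : ∀ i ∈ J, L.num s i < L.num s a) :
    M.StableSet s (insert a J) (Market.choiceStep L s K a) := by
  have ha : a ∉ J := fun e => lt_irrefl _ (hlt a e)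
  have haK : a ∉ K := fun e => ha (hK.subset e)
  have hq : (∅ : Finset I).card < M.q s := M.q_pos s
  unfold Market.choiceStep
  split_ifs with hc hacc
  · refine hK.insert_insert h ha hc (Finset.mem_insert_self a K) rfl (fun i hi hia ht => ?_)
      (by rwa [Finset.erase_insert haK])
    exact L.prio_of_lt s i a ht (hlt i (hK.subset ((Finset.mem_insert.1 hi).resolve_left hia)))
      ∅ hq (by simp) (by simp)
  · refine hK.insert_right (fun j hj => ?_) fun _ => hacc
    have hcj := hK.card_erase_lt hj
    have ha1 : a ∉ K.erase j := fun e => haK (Finset.mem_of_mem_erase e)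
    by_cases ht : M.type s (some j) = M.type s (some a)
    · exact L.prio_of_lt s j a ht (hlt j (hK.subset hj)) _ hcj (by simp) ha1
    · refine h.prio_of_accept hcj (by simp) ha1 (hK.acceptable j hj) fun h1 => hacc ?_
      refine h.transfer_none hcj hc ha1 haK ?_ h1
      rw [typeCount_erase hj, if_neg ht]; omega
  · have hc : K.card = M.q s := le_antisymm hK.card_le (not_lt.1 hc)
    have hcard : (insert a K).card = M.q s + 1 := by rw [Finset.card_insert_of_notMem haK, hc]
    obtain ⟨r, hr, hmin⟩ := h.exists_lowest (K := insert a K) (by simp) hcard.le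
    -- By antisymmetry the lowest student is unique, so the tie-break by number has no effect.
    have hlow : lowest M s (insert a K) = {r} := by
      ext i
      simp only [lowest, Finset.mem_filter, Finset.mem_singleton]
      constructor
      · rintro ⟨hi, hmin'⟩
        by_contra hir
        have h1 := Finset.card_erase_add_one hr
        have h2 := Finset.card_erase_add_one (Finset.mem_erase.2 ⟨hir, hi⟩)
        refine h.antisymm (by omega) (by simp) (by simp) hir (hmin i hi hir) ?_
        rw [Finset.erase_right_comm]
        exact hmin' r hr (Ne.symm hir)
      · rintro rfl
        exact ⟨hr, hmin⟩
    have hlate : latestLowest L s (insert a K) = {r} := by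
      ext i
      simp [latestLowest, hlow]
      rintro rfl
      exact le_rfl
    rw [hlate, Finset.sdiff_singleton_eq_erase]
    by_cases hr' : r = a
    · subst hr'
      rw [Finset.erase_insert haK]
      refine hK.insert_right (fun j hj => ?_) (by omega)
      have := hmin j (Finset.mem_insert_of_mem hj) (fun e => haK (e ▸ hj))
      rwa [Finset.erase_insert haK] at this
    · have hrK := (Finset.mem_insert.1 hr).resolve_left hr'
      obtain ⟨B, hrB, rfl⟩ : ∃ B, r ∉ B ∧ K = insert r B :=
        ⟨K.erase r, by simp, (Finset.insert_erase hrK).symm⟩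
      have e : (insert a (insert r B)).erase r = insert a B := by
        rw [Finset.erase_insert_of_ne (Ne.symm hr'), Finset.erase_insert hrB]
      rw [e] at hmin ⊢
      refine hK.replace_of_full h hrB ha hc (fun i hi => hmin i ?_ ?_)
      · exact Finset.insert_subset_insert _ (Finset.subset_insert _ _) hi
      · rintro rfl
        rw [← e] at hi
        simp at hi

theorem stableSet_choice (h : M.Regular s) (L : M.Labelling) (J : Finset I) :
    M.StableSet s J (choice L s J) := by
  have key (l : List I) (hl : l.Pairwise fun i j => L.num s i < L.num s j) :
      M.StableSet s l.toFinset (l.foldl (Market.choiceStep L s) ∅) := by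
    induction l using List.reverseRecOn with
    | nil => simpa using StableSet.empty
    | append_singleton l a ih =>
      rw [List.pairwise_append] at hl
      have e : (l ++ [a]).toFinset = insert a l.toFinset := by ext; simp
      rw [List.foldl_append, e]
      exact (ih hl.1).choiceStep h L fun i hi => hl.2.2 i (by simpa using hi) a (by simp)
  have := key _ (sorted_pairwise L s J)
  rwa [sorted_toFinset] at this

/-- In particular the choice does not depend on the numbering. -/
theorem StableSet.eq_choice (h : M.Regular s) (L : M.Labelling) {J K : Finset I}
    (hK : M.StableSet s J K) : K = choice L s J :=
  hK.unique h (stableSet_choice h L J)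

theorem choice_insert (h : M.Regular s) (L : M.Labelling) {J : Finset I} {a : I} (ha : a ∉ J) :
    choice L s (insert a J) ⊆ insert a (choice L s J) ∧
      (choice L s J).card ≤ (choice L s (insert a J)).card := by
  obtain ⟨K', hK', h1, h2⟩ := (stableSet_choice h L J).exists_insert h ha
  rw [← hK'.eq_choice h L]
  exact ⟨h1, h2⟩

/-- Applicants are added one at a time: each addition brings nobody back except possibly the
newcomer, and does not shrink the choice. -/
theorem choice_superset (h : M.Regular s) (L : M.Labelling) {J J' : Finset I} (hJ : J ⊆ J') :
    (∀ a ∈ J, a ∈ choice L s J' → a ∈ choice L s J) ∧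
      (choice L s J).card ≤ (choice L s J').card := by
  obtain ⟨D, rfl⟩ : ∃ D, J' = D ∪ J := ⟨J', (Finset.union_eq_left.2 hJ).symm⟩
  clear hJ
  induction D using Finset.induction_on with
  | empty => simp
  | insert a D _ ih =>
    rw [Finset.insert_union]
    by_cases ha : a ∈ D ∪ J
    · rwa [Finset.insert_eq_self.2 ha]
    · obtain ⟨h1, h2⟩ := choice_insert h L ha
      refine ⟨fun b hb hbC => ih.1 b hb ((Finset.mem_insert.1 (h1 hbC)).resolve_left ?_),
        ih.2.trans h2⟩
      rintro rfl
      exact ha (Finset.mem_union_right _ hb)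

theorem isChoiceRule_choice (h : M.Regular s) (L : M.Labelling) : IsChoiceRule (choice L s) where
  subset J := (stableSet_choice h L J).subset
  substitutes hJ ha haC := (choice_superset h L hJ).1 _ ha haC
  consistent {_ J'} hC hJ := ((stableSet_choice h L J').mono hC hJ |>.eq_choice h L).symm
  aggregate_demand hJ := (choice_superset h L hJ).2

end Choice
end Market

/-! ### Student preferences -/

namespace Preference

variable {S : Type*} (p : Preference S)

theorem refl (x : Option S) : p.R x x := (p.total x x).elim id id

theorem R_of_not_P {x y : Option S} (h : ¬ p.P x y) : p.R y x := by
  by_contra h1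
  refine h ⟨(p.total x y).resolve_right h1, ?_⟩
  rintro rfl
  exact h1 (p.refl x)

theorem not_P_of_R {x y : Option S} (h : p.R y x) : ¬ p.P x y := fun h1 =>
  h1.2 (p.antisymm _ _ h1.1 h)

theorem exists_best [Finite S] {X : Set S} (hX : X.Nonempty) :
    ∃ s ∈ X, ∀ s' ∈ X, p.R (some s) (some s') := by
  have := Fintype.ofFinite S
  classical
  obtain ⟨m, hm, hmin⟩ := Market.exists_least_of_total
    (r := fun s s' => p.R (some s') (some s)) (Finset.univ.filter (· ∈ X))
    (by obtain ⟨x, hx⟩ := hX; exact ⟨x, by simpa using hx⟩)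
    (fun i _ j _ _ => p.total _ _) (fun i _ j _ k _ _ _ _ h1 h2 => p.trans _ _ _ h2 h1)
  refine ⟨m, by simpa using hm, fun s' hs' => ?_⟩
  by_cases e : s' = m
  · rw [e]; exact p.refl _
  · exact hmin s' (by simpa using hs') e

end Preference

/-! ### Invariants and termination of deferred acceptance -/

namespace SPDAState

variable {I S : Type*}

/-- `i` has applied to `s` before the state `σ` was reached. -/
def Applied (σ : SPDAState I S) (i : I) (s : S) : Prop :=
  i ∈ σ.held s ∨ s ∈ σ.rejected i

open Classical in
/-- All students who have applied to `s` so far. -/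
noncomputable def pool [Fintype I] (σ : SPDAState I S) (s : S) : Finset I :=
  Finset.univ.filter fun i => σ.Applied i s

theorem mem_pool [Fintype I] {σ : SPDAState I S} {s : S} {i : I} :
    i ∈ σ.pool s ↔ σ.Applied i s := by
  simp [pool]

/-- The invariants of deferred acceptance: nobody is held twice, nobody is held by a school that
has rejected them, applications are made to acceptable schools in the order of preference, and
every school holds its choice from all its applicants. -/
structure Valid [Fintype I] (C : S → Finset I → Finset I) (P : I → Preference S)
    (σ : SPDAState I S) : Prop where
  held_unique : ∀ {i s s'}, i ∈ σ.held s → i ∈ σ.held s' → s = s'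
  notMem_rejected : ∀ {i s}, i ∈ σ.held s → s ∉ σ.rejected i
  acceptable : ∀ {i s}, σ.Applied i s → (P i).R (some s) none
  best : ∀ {i s s'}, σ.Applied i s → s' ∉ σ.rejected i → (P i).R (some s) (some s')
  choice_pool : ∀ s, C s (σ.pool s) = σ.held s

variable {C : S → Finset I → Finset I} {P : I → Preference S} {σ σ' : SPDAState I S} {i j : I}
  {s s' : S}

theorem valid_init [Fintype I] (hC : ∀ s, IsChoiceRule (C s)) : (SPDAState.init I S).Valid C P where
  held_unique h := by simp [SPDAState.init] at h
  notMem_rejected h := by simp [SPDAState.init] at h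
  acceptable h := by simp [Applied, SPDAState.init] at h
  best h := by simp [Applied, SPDAState.init] at h
  choice_pool s := by
    have : (SPDAState.init I S).pool s = ∅ := by
      ext; simp [mem_pool, Applied, SPDAState.init]
    rw [this]
    exact Finset.subset_empty.1 ((hC s).subset ∅)

variable [DecidableEq I] [DecidableEq S]

theorem held_apply_self : (σ.apply C i s).held s = C s (insert i (σ.held s)) := by
  simp [SPDAState.apply]

theorem held_apply_of_ne (h : s' ≠ s) : (σ.apply C i s).held s' = σ.held s' := by
  simp [SPDAState.apply, h]

theorem mem_rejected_apply : s' ∈ (σ.apply C i s).rejected j ↔ s' ∈ σ.rejected j ∨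
    (s' = s ∧ j ∈ insert i (σ.held s) ∧ j ∉ C s (insert i (σ.held s))) := Iff.rfl

theorem applied_apply (hC : ∀ s, IsChoiceRule (C s)) :
    (σ.apply C i s).Applied j s' ↔ σ.Applied j s' ∨ (s' = s ∧ j = i) := by
  unfold Applied
  rw [mem_rejected_apply]
  by_cases h : s' = s
  · subst h
    rw [held_apply_self]
    have := @(hC s').subset (insert i (σ.held s')) j
    simp only [Finset.mem_insert] at *
    tauto
  · simp [held_apply_of_ne h, h]

theorem rejected_mono (hr : Relation.ReflTransGen (SPDAState.Round C P) σ σ')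
    (hs : s ∈ σ.rejected i) : s ∈ σ'.rejected i := by
  induction hr with
  | refl => exact hs
  | tail _ h1 ih =>
    obtain ⟨_, _, _, _, _, rfl⟩ := h1
    exact Or.inl ih

variable [Fintype I]

theorem Valid.apply (hC : ∀ s, IsChoiceRule (C s)) (h : σ.Valid C P) (hi : σ.Active P i)
    (hs : s ∉ σ.rejected i) (hbest : ∀ s', s' ∉ σ.rejected i → (P i).R (some s) (some s')) :
    (σ.apply C i s).Valid C P where
  held_unique {j s1 s2} h1 h2 := by
    have key (s' : S) (hne : s' ≠ s) (h1 : j ∈ (σ.apply C i s).held s)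
        (h2 : j ∈ (σ.apply C i s).held s') : False := by
      rw [held_apply_self] at h1
      rw [held_apply_of_ne hne] at h2
      by_cases hji : j = i
      · exact hi.1 _ (hji ▸ h2)
      · exact hne (h.held_unique h2
          ((Finset.mem_insert.1 ((hC s).subset _ h1)).resolve_left hji))
    by_cases e1 : s1 = s
    · by_contra hne
      subst e1
      exact key s2 (Ne.symm hne) h1 h2
    · by_cases e2 : s2 = s
      · subst e2
        exact (key s1 e1 h2 h1).elim
      · rw [held_apply_of_ne e1] at h1
        rw [held_apply_of_ne e2] at h2
        exact h.held_unique h1 h2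
  notMem_rejected {j s'} h1 h2 := by
    by_cases e : s' = s
    · subst e
      rw [held_apply_self] at h1
      rcases mem_rejected_apply.1 h2 with h3 | h3
      · by_cases hji : j = i
        · exact hs (hji ▸ h3)
        · exact h.notMem_rejected
            ((Finset.mem_insert.1 ((hC s').subset _ h1)).resolve_left hji) h3
      · exact h3.2.2 h1
    · rw [held_apply_of_ne e] at h1
      rcases mem_rejected_apply.1 h2 with h2 | h2
      · exact h.notMem_rejected h1 h2
      · exact e h2.1
  acceptable h1 := by
    rcases (applied_apply hC).1 h1 with h1 | ⟨rfl, rfl⟩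
    · exact h.acceptable h1
    · obtain ⟨s0, h2, h3⟩ := hi.2
      exact (P _).trans _ _ _ (hbest s0 h3) h2
  best h1 h2 := by
    have h3 := fun e => h2 (mem_rejected_apply.2 (Or.inl e))
    rcases (applied_apply hC).1 h1 with h1 | ⟨rfl, rfl⟩
    · exact h.best h1 h3
    · exact hbest _ h3
  choice_pool s' := by
    by_cases e : s' = s
    · subst e
      have hpool : (σ.apply C i s').pool s' = insert i (σ.pool s') := by
        ext j
        rw [mem_pool, applied_apply hC, Finset.mem_insert, mem_pool]
        simp [or_comm]
      rw [held_apply_self, hpool]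
      -- By substitutability, whoever is chosen from the enlarged pool is `i` or was held. Choosing
      -- from the held students and `i` thus amounts to choosing from all past applicants.
      refine ((hC s').consistent (fun j hj => ?_) ?_).symm
      · rcases Finset.mem_insert.1 ((hC s').subset _ hj) with rfl | hj'
        · exact Finset.mem_insert_self _ _
        · rw [← h.choice_pool]
          exact Finset.mem_insert_of_mem
            ((hC s').substitutes (Finset.subset_insert _ _) hj' hj)
      · exact Finset.insert_subset_insert _ fun j hj => mem_pool.2 (Or.inl hj)
    · have hpool : (σ.apply C i s).pool s' = σ.pool s' := by
        ext j
        rw [mem_pool, applied_apply hC, mem_pool]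
        simp [e]
      rw [held_apply_of_ne e, hpool]
      exact h.choice_pool s'

theorem Valid.round (hC : ∀ s, IsChoiceRule (C s)) (h : σ.Valid C P)
    (hr : SPDAState.Round C P σ σ') : σ'.Valid C P := by
  obtain ⟨i, s, h1, h2, h3, rfl⟩ := hr
  exact h.apply hC h1 h2 h3

theorem Valid.reflTransGen (hC : ∀ s, IsChoiceRule (C s)) (h : σ.Valid C P)
    (hr : Relation.ReflTransGen (SPDAState.Round C P) σ σ') : σ'.Valid C P := by
  induction hr with
  | refl => exact h
  | tail _ h1 ih => exact ih.round hC h1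

/-- Each round uses up a student–school pair for which no application had been made. -/
theorem exists_terminal [Fintype S] (hC : ∀ s, IsChoiceRule (C s)) (h : σ.Valid C P) :
    ∃ σ', Relation.ReflTransGen (SPDAState.Round C P) σ σ' ∧ ∀ i, ¬ σ'.Active P i := by
  classical
  induction hn : (Finset.univ.filter fun x : I × S => ¬ σ.Applied x.1 x.2).card
    using Nat.strong_induction_on generalizing σ with
  | _ n ih =>
    by_cases hact : ∃ i, σ.Active P i
    · obtain ⟨i, hi⟩ := hact
      obtain ⟨s, hs, hbest⟩ := (P i).exists_best (X := {s | s ∉ σ.rejected i})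
        (by obtain ⟨s, _, hs⟩ := hi.2; exact ⟨s, hs⟩)
      obtain ⟨σ', h1, h2⟩ := ih _ (by
        rw [← hn]
        refine Finset.card_lt_card ((Finset.ssubset_iff_of_subset fun x hx => ?_).2
          ⟨(i, s), ?_, ?_⟩)
        · simp only [Finset.mem_filter, Finset.mem_univ, true_and, applied_apply hC] at hx ⊢
          exact fun hx' => hx (Or.inl hx')
        · simp only [Finset.mem_filter, Finset.mem_univ, true_and]
          rintro (h3 | h3)
          · exact hi.1 s h3
          · exact hs h3
        · simp [applied_apply hC]) (h.apply hC hi hs hbest) rfl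
      exact ⟨σ', Relation.ReflTransGen.head ⟨i, s, hi, hs, hbest, rfl⟩ h1, h2⟩
    · exact ⟨σ, Relation.ReflTransGen.refl, not_exists.1 hact⟩

end SPDAState

theorem Relation.ReflTransGen.exists_step {α : Type*} {r : α → α → Prop} {p : α → Prop} {a b : α}
    (h : Relation.ReflTransGen r a b) (ha : ¬ p a) (hb : p b) :
    ∃ c d, Relation.ReflTransGen r a c ∧ r c d ∧ Relation.ReflTransGen r d b ∧ ¬ p c ∧ p d := by
  induction h using Relation.ReflTransGen.head_induction_on with
  | refl => exact absurd hb ha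
  | head h1 h2 ih =>
    rename_i x y
    by_cases hy : p y
    · exact ⟨x, y, .refl, h1, h2, ha, hy⟩
    · obtain ⟨c, d, h3, h4⟩ := ih hy
      exact ⟨c, d, .head h1 h3, h4⟩

theorem card_filter_none_add_sum {I S : Type*} [Fintype I] [Fintype S] [DecidableEq S]
    (f : I → Option S) :
    (Finset.univ.filter fun i => f i = none).card +
      ∑ s, (Finset.univ.filter fun i => f i = some s).card = Fintype.card I := by
  have := Finset.card_eq_sum_card_fiberwise (f := f) (s := Finset.univ) (t := Finset.univ)
    (fun _ _ => Finset.mem_coe.2 (Finset.mem_univ _))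
  rw [Fintype.sum_option] at this
  exact this.symm

/-! ### Stability in terms of choice functions -/

namespace Market

variable {I S T : Type*} [Fintype I]

theorem Matching.mem_at [DecidableEq S] {M : Market I S T} {μ : M.Matching} {i : I} {s : S} :
    i ∈ μ.at s ↔ μ.assign i = some s := by
  simp [Matching.at]

open Classical in
/-- The students for whom `s` is at least as good as their assignment in `x`. -/
noncomputable def demand (P : I → Preference S) (x : I → Option S) (s : S) : Finset I :=
  Finset.univ.filter fun i => (P i).R (some s) (x i)

theorem mem_demand {P : I → Preference S} {x : I → Option S} {s : S} {i : I} :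
    i ∈ demand P x s ↔ (P i).R (some s) (x i) := by
  simp [demand]

/-- Stability of a matching in terms of choice functions. -/
def ChoiceStable [DecidableEq S] {M : Market I S T} (C : S → Finset I → Finset I) (P : I → Preference S) (μ : M.Matching) : Prop :=
  (∀ i, (P i).R (μ.assign i) none) ∧ ∀ s, C s (demand P μ.assign s) = μ.at s

end Market

/-! ### Stability, optimality and incentives of the outcome -/

section DeferredAcceptanceOutcome

open Market SPDAState

variable {I S T : Type*} [Fintype I] [DecidableEq S] {M : Market I S T}
  {C : S → Finset I → Finset I} {P : I → Preference S} {μ ν : M.Matching}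

theorem SPDAState.mem_held_iff {σ : SPDAState I S} (hμ : ∀ s, μ.at s = σ.held s) {i : I} {s : S} :
    i ∈ σ.held s ↔ μ.assign i = some s := by
  rw [← hμ, Matching.mem_at]

namespace SPDAState.Valid

variable {σ : SPDAState I S}

theorem assign_acceptable (hσ : σ.Valid C P) (hμ : ∀ s, μ.at s = σ.held s) (i : I) :
    (P i).R (μ.assign i) none := by
  rcases h : μ.assign i with _ | s
  · exact (P i).refl _
  · exact hσ.acceptable (Or.inl ((mem_held_iff hμ).2 h))

theorem le_assign_of_applied (hσ : σ.Valid C P) (hμ : ∀ s, μ.at s = σ.held s) {i : I} {s : S}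
    (h : σ.Applied i s) : (P i).R (some s) (μ.assign i) := by
  rcases h' : μ.assign i with _ | s'
  · exact hσ.acceptable h
  · exact hσ.best h (hσ.notMem_rejected ((mem_held_iff hμ).2 h'))

/-- Students apply in order of preference and stop only when held or out of acceptable schools, so
at the end every school at least as good as the assignment has been tried. -/
theorem demand_subset_pool (hσ : σ.Valid C P) (ht : ∀ i, ¬ σ.Active P i)
    (hμ : ∀ s, μ.at s = σ.held s) {i : I} {s : S} (h : (P i).R (some s) (μ.assign i)) :
    σ.Applied i s := by
  by_cases e : μ.assign i = some s
  · exact Or.inl ((mem_held_iff hμ).2 e)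
  refine Or.inr ?_
  by_contra hs
  rcases h' : μ.assign i with _ | s'
  · refine ht i ⟨fun s'' h'' => ?_, s, h' ▸ h, hs⟩
    rw [mem_held_iff hμ, h'] at h''
    cases h''
  · rw [h'] at h e
    exact e ((P i).antisymm _ _ (hσ.best (Or.inl ((mem_held_iff hμ).2 h')) hs) h)

theorem choiceStable (hσ : σ.Valid C P)
    (ht : ∀ i, ¬ σ.Active P i) (hμ : ∀ s, μ.at s = σ.held s) : ChoiceStable C P μ := by
  refine ⟨hσ.assign_acceptable hμ, fun s => ?_⟩
  have : demand P μ.assign s = σ.pool s := by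
    ext i
    rw [mem_demand, mem_pool]
    exact ⟨hσ.demand_subset_pool ht hμ, hσ.le_assign_of_applied hμ⟩
  rw [this, hμ, hσ.choice_pool]

end SPDAState.Valid

variable [DecidableEq I]

theorem IsSPDAOutcome.exists [Fintype S] (hC : ∀ s, IsChoiceRule (C s))
    (hq : ∀ s J, (C s J).card ≤ M.q s) (P : I → Preference S) :
    ∃ μ : M.Matching, IsSPDAOutcome C P μ := by
  classical
  obtain ⟨σ, hr, ht⟩ := exists_terminal hC (valid_init (P := P) hC)
  have hσ := (valid_init hC).reflTransGen hC hr
  let x : I → Option S := fun i => if h : ∃ s, i ∈ σ.held s then some h.choose else none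
  have hx (i : I) (s : S) : x i = some s ↔ i ∈ σ.held s := by
    by_cases h : ∃ s, i ∈ σ.held s
    · simp only [x, dif_pos h, Option.some.injEq]
      exact ⟨fun e => e ▸ h.choose_spec, fun e => hσ.held_unique h.choose_spec e⟩
    · simp only [x, dif_neg h, reduceCtorEq, false_iff]
      exact fun e => h ⟨s, e⟩
  have hfilter (s : S) : (Finset.univ.filter fun i => x i = some s) = σ.held s := by
    ext i; simp [hx]
  exact ⟨⟨x, fun s => by rw [hfilter, ← hσ.choice_pool]; exact hq _ _⟩, σ, hr, ht, hfilter⟩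

/-- During deferred acceptance no student is rejected by a school that some stable matching
assigns to them. -/
theorem Market.ChoiceStable.notMem_rejected (hC : ∀ s, IsChoiceRule (C s)) (hν : ChoiceStable C P ν)
    {σ : SPDAState I S}
    (hr : Relation.ReflTransGen (SPDAState.Round C P) (SPDAState.init I S) σ) {i : I} {s : S}
    (hi : ν.assign i = some s) : s ∉ σ.rejected i := by
  induction hr generalizing i s with
  | refl => simp [SPDAState.init]
  | @tail σ _ hr hstep ih =>
    have hσ := (valid_init hC).reflTransGen hC hr
    obtain ⟨a, s', hact, hs', hbest, rfl⟩ := hstep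
    intro hrej
    rcases mem_rejected_apply.1 hrej with h | ⟨rfl, h1, h2⟩
    · exact ih hi h
    -- By induction nobody here has been rejected by their school at `ν`, so all of them weakly
    -- prefer `s` to `ν`. Substitutability then makes `s` reject `i` from its demand at `ν` as well.
    · have hsub : insert a (σ.held s) ⊆ demand P ν.assign s := by
        intro j hj
        rw [mem_demand]
        rcases h : ν.assign j with _ | s1
        · rcases Finset.mem_insert.1 hj with rfl | hj
          · obtain ⟨s0, h3, h4⟩ := hact.2
            exact (P j).trans _ _ _ (hbest s0 h4) h3
          · exact hσ.acceptable (Or.inl hj)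
        · rcases Finset.mem_insert.1 hj with rfl | hj
          · exact hbest s1 (ih h)
          · exact hσ.best (Or.inl hj) (ih h)
      refine h2 ((hC s).substitutes hsub h1 ?_)
      rw [hν.2 s, Matching.mem_at, hi]

theorem IsSPDAOutcome.choiceStable (hC : ∀ s, IsChoiceRule (C s)) (h : IsSPDAOutcome C P μ) :
    ChoiceStable C P μ := by
  obtain ⟨σ, hr, ht, hμ⟩ := h
  exact ((valid_init hC).reflTransGen hC hr).choiceStable ht hμ

theorem IsSPDAOutcome.optimal (hC : ∀ s, IsChoiceRule (C s)) (h : IsSPDAOutcome C P μ)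
    (hν : ChoiceStable C P ν) (i : I) : (P i).R (μ.assign i) (ν.assign i) := by
  obtain ⟨σ, hr, ht, hμ⟩ := h
  have hσ := (valid_init hC).reflTransGen hC hr
  refine (P i).R_of_not_P fun hP => ?_
  rcases hi : ν.assign i with _ | s
  · rw [hi] at hP
    exact (P i).not_P_of_R (hσ.assign_acceptable hμ i) hP
  · rw [hi] at hP
    rcases hσ.demand_subset_pool ht hμ hP.1 with h | h
    · exact hP.2 ((mem_held_iff hμ).1 h).symm
    · exact hν.notMem_rejected hC hr hi h

/-- Let `x` be a matching in which every school `s` makes its choice from the students assigned to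
it and the students who do not prefer `x` to the deferred acceptance outcome `μ` and weakly prefer
`s` to `x`. Then no student prefers `x` to `μ`. -/
theorem IsSPDAOutcome.not_exists_improvement [Fintype S] (hC : ∀ s, IsChoiceRule (C s))
    (h : IsSPDAOutcome C P μ) (x : M.Matching) (V : S → Finset I)
    (hVmem : ∀ s j, j ∈ V s ↔ x.assign j = some s ∨
      ¬ (P j).P (x.assign j) (μ.assign j) ∧ (P j).R (some s) (x.assign j))
    (hV : ∀ s, C s (V s) = x.at s) (i : I) : ¬ (P i).P (x.assign i) (μ.assign i) := by
  classical
  intro hi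
  have hst := h.choiceStable hC
  set A : I → Prop := fun j => (P j).P (x.assign j) (μ.assign j) with hA
  -- The hybrid: improvers keep `μ`, all others keep `x`.
  let w : I → Option S := fun j => if A j then μ.assign j else x.assign j
  let W : S → Finset I := fun s => Finset.univ.filter fun j => w j = some s
  have hAx {j : I} (hj : A j) : x.assign j ≠ none := fun e => by
    rw [hA, e] at hj
    exact (P j).not_P_of_R (hst.1 j) hj
  have hUV (s : S) : C s (demand P μ.assign s ∪ V s) ⊆ W s := by
    intro j hj
    have hj' := (hC s).subset _ hj
    simp only [W, w, Finset.mem_filter, Finset.mem_univ, true_and]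
    rw [Finset.mem_union, mem_demand, hVmem] at hj'
    by_cases hAj : A j
    · rw [if_pos hAj, ← Matching.mem_at, ← hst.2 s]
      refine (hC s).substitutes Finset.subset_union_left (mem_demand.2 ?_) hj
      rcases hj' with hj' | hj' | hj'
      · exact hj'
      · rw [← hj']; exact hAj.1
      · exact absurd hAj hj'.1
    · rw [if_neg hAj, ← Matching.mem_at, ← hV s]
      refine (hC s).substitutes Finset.subset_union_right ((hVmem s j).2 ?_) hj
      rcases hj' with hj' | hj'
      · exact Or.inr ⟨hAj, (P j).trans _ _ _ hj' ((P j).R_of_not_P hAj)⟩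
      · exact hj'
  have hle (s : S) : (x.at s).card ≤ (W s).card := by
    rw [← hV s]
    exact ((hC s).aggregate_demand Finset.subset_union_right).trans (Finset.card_le_card (hUV s))
  have hsub : (Finset.univ.filter fun j => x.assign j = none) ⊆
      Finset.univ.filter fun j => w j = none := by
    intro j hj
    simp only [w, Finset.mem_filter, Finset.mem_univ, true_and] at hj ⊢
    rw [if_neg fun hAj => hAx hAj hj, hj]
  -- Both assignments count all of `I`, and neither any school nor the unmatched group is smaller
  -- under `w`. So equality holds throughout, and every improver is matched at `μ`.
  have hsum : (Finset.univ.filter fun j => x.assign j = none).card + ∑ s, (x.at s).card =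
      (Finset.univ.filter fun j => w j = none).card + ∑ s, (W s).card :=
    (card_filter_none_add_sum x.assign).trans (card_filter_none_add_sum w).symm
  have hsumle := Finset.sum_le_sum (s := Finset.univ) fun s _ => hle s
  have hcard (s : S) : (x.at s).card = (W s).card := by
    refine (hle s).eq_of_not_lt fun hlt => ?_
    have h1 := Finset.sum_lt_sum (s := Finset.univ) (fun s _ => hle s) ⟨s, Finset.mem_univ _, hlt⟩
    have h2 := Finset.card_le_card hsub
    omega
  have hmatched {j : I} (hj : A j) : ∃ s, μ.assign j = some s := by
    have heq := Finset.eq_of_subset_of_card_le hsub (by omega)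
    by_contra! hnone
    have : j ∈ Finset.univ.filter fun j => w j = none := by
      simp only [w, Finset.mem_filter, Finset.mem_univ, true_and, if_pos hj]
      exact Option.eq_none_iff_forall_ne_some.2 hnone
    rw [← heq] at this
    exact hAx hj (by simpa using this)
  obtain ⟨σf, hr, ht, hμ⟩ := h
  -- The round after which all improvers are held by their schools at `μ`, though before it they
  -- were not. The applicant `a` must be an improver applying to `μ(a)`, and all other improvers are
  -- already in place.
  obtain ⟨σ, σ', hr1, hstep, hr2, hn, hy⟩ := hr.exists_step
    (p := fun σ => ∀ j s, A j → μ.assign j = some s → j ∈ σ.held s)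
    (fun hall => by
      obtain ⟨s, hs⟩ := hmatched hi
      simpa [SPDAState.init] using hall i s hi hs)
    (fun j s _ hj => (mem_held_iff hμ).2 hj)
  have hσ := (valid_init hC).reflTransGen hC hr1
  have hσf := (valid_init hC).reflTransGen hC hr
  have hrej {j : I} {s : S} (hs : s ∈ σ.rejected j) : s ∈ σf.rejected j :=
    rejected_mono (Relation.ReflTransGen.head hstep hr2) hs
  obtain ⟨a, s, hact, hsa, hbest, rfl⟩ := hstep
  have hy' {j : I} {s' : S} (hj : A j) (hs' : μ.assign j = some s') (hne : j ≠ a) :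
      j ∈ σ.held s' := by
    have := hy j s' hj hs'
    by_cases e : s' = s
    · subst e
      rw [held_apply_self] at this
      exact (Finset.mem_insert.1 ((hC s').subset _ this)).resolve_left hne
    · rwa [held_apply_of_ne e] at this
  have hAa : A a := by
    by_contra hAa
    exact hn fun j s' hj hs' => hy' hj hs' fun e => hAa (e ▸ hj)
  have hμa : μ.assign a = some s := by
    obtain ⟨s', hs'⟩ := hmatched hAa
    have := hy a s' hAa hs'
    by_cases e : s' = s
    · rw [hs', e]
    · rw [held_apply_of_ne e] at this
      exact absurd this (hact.1 s')
  have hle_assign {j : I} {s : S} (hj : σ.Applied j s) : (P j).R (some s) (μ.assign j) := by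
    rcases hj' : μ.assign j with _ | s'
    · exact hσ.acceptable hj
    · exact hσ.best hj fun e =>
        hσf.notMem_rejected ((mem_held_iff hμ).2 hj') (hrej e)
  -- An improver chosen here has applied to `s`, so by substitutability is already held there; this
  -- excludes the unheld `a`. Yet aggregate demand requires at least as many students as `W s`,
  -- which contains `a`.
  have hbound : C s (V s ∪ σ.pool s) ⊆ (W s).erase a := by
    intro j hj
    have hj' := (hC s).subset _ hj
    simp only [W, w, Finset.mem_erase, Finset.mem_filter, Finset.mem_univ, true_and]
    rw [Finset.mem_union, hVmem, mem_pool] at hj'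
    by_cases hAj : A j
    · have happ : σ.Applied j s := by
        rcases hj' with (hj' | hj') | hj'
        · obtain ⟨s1, hs1⟩ := hmatched hAj
          have hP : (P j).P (some s) (some s1) := by
            rw [← hj', ← hs1]; exact hAj
          have hja : j ≠ a := by
            rintro rfl
            rw [hμa] at hs1
            exact hP.2 hs1
          refine Or.inr (by_contra fun hs => ?_)
          exact (P j).not_P_of_R (hσ.best (Or.inl (hy' hAj hs1 hja)) hs) hP
        · exact absurd hAj hj'.1
        · exact hj'
      have hheld : j ∈ σ.held s := by
        rw [← hσ.choice_pool]
        exact (hC s).substitutes Finset.subset_union_right (mem_pool.2 happ) hj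
      have hja : j ≠ a := by
        rintro rfl
        exact hact.1 s hheld
      obtain ⟨s1, hs1⟩ := hmatched hAj
      rw [if_pos hAj, hs1, hσ.held_unique hheld (hy' hAj hs1 hja)]
      exact ⟨hja, rfl⟩
    · rw [if_neg hAj, ← Matching.mem_at, ← hV s]
      refine ⟨fun e => hAj (e ▸ hAa),
        (hC s).substitutes Finset.subset_union_left ((hVmem s j).2 ?_) hj⟩
      rcases hj' with hj' | hj'
      · exact hj'
      · exact Or.inr ⟨hAj, (P j).trans _ _ _ (hle_assign hj') ((P j).R_of_not_P hAj)⟩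
  have haW : a ∈ W s := by
    simp only [W, w, Finset.mem_filter, Finset.mem_univ, true_and, if_pos hAa, hμa]
  have h1 := (hC s).aggregate_demand (J := V s) (J' := V s ∪ σ.pool s) Finset.subset_union_left
  rw [hV s, hcard s] at h1
  have h2 := Finset.card_le_card hbound
  have h3 := Finset.card_erase_lt_of_mem haW
  omega

/-- Deferred acceptance for substitutable choice functions with the law of aggregate demand is
group strategy-proof. -/
theorem isGroupStrategyProof_of_isSPDAOutcome [Fintype S] (hC : ∀ s, IsChoiceRule (C s))
    {φ : (I → Preference S) → M.Matching} (hφ : ∀ P, IsSPDAOutcome C P (φ P)) :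
    IsGroupStrategyProof φ := by
  classical
  rintro P P' G ⟨g, hg⟩ hP' hG
  -- Students who do not improve are outside `G` and report truthfully. So these sets lie between
  -- the assigned students and the demand under `P'`, and consistency leaves the choice unchanged.
  refine (hφ P).not_exists_improvement hC (φ P')
    (fun s => Finset.univ.filter fun j => (φ P').assign j = some s ∨
      ¬ (P j).P ((φ P').assign j) ((φ P).assign j) ∧ (P j).R (some s) ((φ P').assign j))
    (fun s j => by simp) (fun s => ?_) g (hG g hg)
  have hst := ((hφ P').choiceStable hC).2 s
  rw [← hst]
  refine (hC s).consistent (fun j hj => ?_) fun j hj => ?_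
  · rw [hst, Matching.mem_at] at hj
    simp [hj]
  · rw [mem_demand]
    rcases (Finset.mem_filter.1 hj).2 with h | h
    · rw [h]; exact (P' j).refl _
    · rw [hP' j fun hjG => h.1 (hG j hjG)]
      exact h.2

end DeferredAcceptanceOutcome

/-! ### Admissible numberings, and stability school by school -/

theorem exists_equivFin_of_total {I : Type*} [Fintype I] (r : I → I → Prop)
    (htot : ∀ i j, r i j ∨ r j i) (htr : ∀ i j k, r i j → r j k → r i k)
    (has : ∀ i j, r i j → r j i → i = j) :
    ∃ e : I ≃ Fin (Fintype.card I), ∀ i j, e i < e j → r i j := by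
  classical
  let _ : LinearOrder I :=
    { le := r
      le_refl := fun i => (htot i i).elim id id
      le_trans := htr
      le_antisymm := has
      le_total := htot
      toDecidableLE := Classical.decRel _ }
  exact ⟨(monoEquivOfFin I rfl).symm.toEquiv, fun i j hij =>
    ((monoEquivOfFin I rfl).symm.lt_iff_lt.1 hij).le⟩

namespace Market

variable {I S T : Type*} [Fintype I] [DecidableEq I]

/-- Students are ordered lexicographically, by type number and then by priority given `∅`; WO
transfers the latter to every other set. -/
theorem nonempty_labelling [Fintype T] [DecidableEq T] {M : Market I S T}
    (h : ∀ s, M.Regular s) : Nonempty M.Labelling := by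
  classical
  have htype (s : S) : ∃ e : T ≃ Fin (Fintype.card T), (e (M.type s none) : ℕ) = 0 :=
    ⟨(Fintype.equivFin T).trans (Equiv.swap (Fintype.equivFin T (M.type s none))
      ⟨0, Fintype.card_pos_iff.2 ⟨M.type s none⟩⟩), by simp⟩
  choose t ht using htype
  have hnum (s : S) : ∃ e : I ≃ Fin (Fintype.card I), ∀ i j, e i < e j →
      t s (M.type s (some i)) < t s (M.type s (some j)) ∨
        (M.type s (some i) = M.type s (some j) ∧ M.prio s ∅ (some i) (some j)) := by
    have hq : (∅ : Finset I).card < M.q s := M.q_pos s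
    refine exists_equivFin_of_total _ (fun i j => ?_) ?_ ?_
    · rcases lt_trichotomy (t s (M.type s (some i))) (t s (M.type s (some j))) with h1 | h1 | h1
      · exact Or.inl (Or.inl h1)
      · have h1 := (t s).injective h1
        exact (M.prio_total s ∅ hq (some i) (some j) (available_some (by simp))
          (available_some (by simp))).imp (fun h2 => Or.inr ⟨h1, h2⟩)
          fun h2 => Or.inr ⟨h1.symm, h2⟩
      · exact Or.inr (Or.inl h1)
    · rintro i j k (h1 | h1) (h2 | h2)
      · exact Or.inl (h1.trans h2)
      · exact Or.inl (h2.1 ▸ h1)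
      · exact Or.inl (h1.1 ▸ h2)
      · exact Or.inr ⟨h1.1.trans h2.1,
          (h s).trans hq (by simp) (by simp) (by simp) h1.2 h2.2⟩
    · rintro i j (h1 | h1) (h2 | h2)
      · exact absurd h1 h2.asymm
      · exact absurd h1 (by simp [h2.1])
      · exact absurd h2 (by simp [h1.1])
      · exact by_contra fun hij => (h s).antisymm hq (by simp) (by simp) hij h1.2 h2.2
  choose n hn using hnum
  refine ⟨⟨t, ht, n, fun s i j hij => ?_, fun s i j htij hij J hJ hi hj => ?_⟩⟩
  · rcases lt_trichotomy (n s i) (n s j) with h1 | h1 | h1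
    · exact h1
    · rw [(n s).injective h1] at hij
      exact absurd hij (lt_irrefl _)
    · rcases hn s j i h1 with h2 | h2
      · exact absurd hij h2.asymm
      · exact absurd hij (by simp [h2.1])
  · rcases hn s i j hij with h2 | h2
    · exact absurd h2 (by simp [htij])
    · exact (h s).within (J := ∅) (M.q_pos s) hJ (by simp) (by simp) hi hj htij h2.2

variable [DecidableEq S] {M : Market I S T} {P : I → Preference S} {μ : M.Matching}

/-- The students in the demand for `s` but not assigned to it are exactly those who strictly prefer
`s`, so each stability condition decomposes over schools. -/
theorem stable_iff_stableSet : Stable P μ ↔ (∀ i, (P i).R (μ.assign i) none) ∧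
    ∀ s, M.StableSet s (demand P μ.assign s) (μ.at s) := by
  have hcap (s : S) : (μ.at s).card ≤ M.q s := μ.capacity s
  have hlt {s : S} {j : I} (hj : j ∈ μ.at s) : ((μ.at s).erase j).card < M.q s :=
    (Finset.card_erase_lt_of_mem hj).trans_le (hcap s)
  have hP {i : I} {s : S} : i ∈ demand P μ.assign s ∧ i ∉ μ.at s ↔
      (P i).P (some s) (μ.assign i) := by
    rw [mem_demand, Matching.mem_at]
    exact and_congr_right fun _ => ne_comm
  constructor
  · rintro ⟨hnw, hir, hfair⟩
    refine ⟨hir.1, fun s => ⟨fun i hi => ?_, hcap s, hir.2 s, fun i hi hi' j hj => ?_,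
      fun i hi hi' hc h1 => ?_⟩⟩
    · rw [mem_demand, Matching.mem_at.1 hi]
      exact (P i).refl _
    · by_contra hji
      refine hfair i j ⟨s, Matching.mem_at.1 hj, hP.1 ⟨hi, hi'⟩, ?_, hji⟩
      exact (M.prio_total s _ (hlt hj) _ _ (available_some (by simp [hi']))
        (available_some (by simp))).resolve_right hji
    · rcases hnw i s (hP.1 ⟨hi, hi'⟩) with h2 | h2
      · exact h2.2 h1
      · omega
  · rintro ⟨hir, hst⟩
    refine ⟨fun i s hi => ?_, ⟨hir, fun s => (hst s).acceptable⟩, ?_⟩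
    · obtain ⟨h1, h2⟩ := hP.2 hi
      refine or_iff_not_imp_right.2 fun hne => ?_
      have hc := lt_of_le_of_ne (hcap s) hne
      have h3 := (hst s).nonwasteful i h1 h2 hc
      exact ⟨(M.prio_total s _ hc _ _ (available_some h2) (available_none _)).resolve_left h3, h3⟩
    · rintro i j ⟨s, hj, hi, _, hn⟩
      obtain ⟨h1, h2⟩ := hP.2 hi
      exact hn ((hst s).fair i h1 h2 j (Matching.mem_at.2 hj))

theorem stable_iff_choiceStable [Fintype T] [DecidableEq T] (h : ∀ s, M.Regular s)
    (L : M.Labelling) : Stable P μ ↔ ChoiceStable (choice L) P μ := by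
  rw [stable_iff_stableSet]
  refine and_congr_right fun _ => forall_congr' fun s => ⟨fun hs => (hs.eq_choice (h s) L).symm,
    fun hs => ?_⟩
  rw [← hs]
  exact stableSet_choice (h s) L _

end Market

/-- If the priorities of all schools satisfy PD, WO and DC and are linear orders, then the
mechanism is well defined (the algorithm terminates in a matching), and whatever admissible
numbering and order of applications is used, it is student-optimal stable and group
strategy-proof. -/
theorem theorem2 {I S T : Type*} [Fintype I] [DecidableEq I] [Fintype S] [DecidableEq S]
    [Fintype T] [DecidableEq T] (M : Market I S T)
    (hPD : ∀ s, M.PD s) (hWO : ∀ s, M.WO s) (hDC : ∀ s, M.DC s)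
    (hlin : ∀ s, M.LinearPriorities s) :
    Nonempty M.Labelling ∧
    ∀ L : M.Labelling,
      (∃ φ : (I → Preference S) → M.Matching, IsPhiBar L φ) ∧
      ∀ φ : (I → Preference S) → M.Matching, IsPhiBar L φ →
        Market.IsStudentOptimalStableMechanism φ ∧ Market.IsGroupStrategyProof φ := by
  classical
  have h : ∀ s, M.Regular s := fun s => ⟨hPD s, hWO s, hDC s, hlin s⟩
  refine ⟨Market.nonempty_labelling h, fun L => ?_⟩
  have hC : ∀ s, IsChoiceRule (Market.choice L s) := fun s => Market.isChoiceRule_choice (h s) L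
  refine ⟨?_, fun φ hφ => ⟨fun P => ⟨?_, fun ν hν hdom => ?_⟩,
    isGroupStrategyProof_of_isSPDAOutcome hC hφ⟩⟩
  · choose φ hφ using fun P => IsSPDAOutcome.exists (M := M) hC
      (fun s J => (Market.stableSet_choice (h s) L J).card_le) P
    exact ⟨φ, hφ⟩
  · exact (Market.stable_iff_choiceStable h L).2 ((hφ P).choiceStable hC)
  · obtain ⟨i, hi⟩ := hdom.2
    exact (P i).not_P_of_R
      ((hφ P).optimal hC ((Market.stable_iff_choiceStable h L).1 hν) i) hi
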